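/- Consider $n$ asynchronous sequential processes $p_1,\dots,p_n$ of which at most $t$ may crash, where $t<n$ is arbitrary. A process that crashes in a run is faulty (it behaves as a non-faulty process until it crashes); the others are non-faulty. The processes communicate by SCD-broadcast, which is defined as follows; all broadcast messages are assumed to be distinct. * Validity: the scd-delivered message sets are non-empty, and every scd-delivered message was previously scd-broadcast by some process. * Integrity: each process scd-delivers a message at most once. * MS-Ordering: if a process scd-delivers first $m\in ms$ and later $m'\in ms'\ne ms$, then no process scd-delivers first $m'\in ns'$ and later $m\in ns\ne ns'$. * Termination-1: if a non-faulty process scd-broadcasts $m$, its invocation terminates and it scd-delivers a set containing $m$. * Termination-2: a message scd-delivered by any process is scd-delivered by every non-faulty process. * Crashes are not detectable: at every instant, the communication events that have occurred so far (including those of processes that have crashed) admit a continuation in which all the processes are non-faulty and the above properties hold. Let $REG[1..m]$ be an array with initial values $v_0[1..m]$. Each process $p_i$ has local variables $done_i\in\{\mathrm{true},\mathrm{false}\}$, $reg_i[1..m]$ (initially $v_0$) and $tsa_i[1..m]$ (an array of timestamps $\langle date, proc\rangle$, ordered lexicographically, all initially $\langle 0,-\rangle$, where $-$ is below every process identity),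 and executes the following algorithm. * snapshot(): $done_i\leftarrow\mathrm{false}$; scd-broadcast $\mathrm{SYNC}(i)$; wait until $done_i$; return $reg_i[1..m]$. * write$(r,v)$: $done_i\leftarrow\mathrm{false}$; scd-broadcast $\mathrm{SYNC}(i)$; wait until $done_i$; $done_i\leftarrow\mathrm{false}$; scd-broadcast $\mathrm{WRITE}(r,v,\langle tsa_i[r].date+1,i\rangle)$; wait until $done_i$; return. * When a message set is scd-delivered, $p_i$ processes it atomically: for each $r$ such that the set contains messages $\mathrm{WRITE}(r,-,-)$, let $ts$ be the greatest timestamp in these messages and $v$ the associated value; if $tsa_i[r]<ts$, then $reg_i[r]\leftarrow v$ and $tsa_i[r]\leftarrow ts$. Then, if the set contains a message $\mathrm{SYNC}(i)$ or $\mathrm{WRITE}(-,-,\langle -,i\rangle)$, $done_i\leftarrow\mathrm{true}$. The application invokes write and snapshot operations arbitrarily, at each process sequentially, and non-faulty processes keep executing their enabled statements. Then, in every such run: 1. every operation invoked by a non-faulty process terminates (wait-freedom, for any number $t<n$ of crashes); 2. the run is linearizable as an MWMR snapshot object: all the completed operations, and possibly some of the operations that were interrupted by a crash, can be arranged in a sequence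 such that an operation that terminates before another one starts precedes it, and each snapshot returns the array whose entry $r$ is the value written by the closest preceding write of register $r$ (or $v_0[r]$ if there is none); 3. the values taken by the arrays $tsa_1,\dots,tsa_n$ at the end of the processing of message sets are totally ordered by the entrywise order of timestamps. -/

import Mathlib

namespace ScdSnapshot

/-! ### The set-constrained delivery broadcast abstraction (SCD-broadcast)

Time is discrete and at most one event of the whole system occurs at each instant. -/

/-- Events by which a process interacts with SCD-broadcast: it invokes `scd_broadcast(msg)`,
returns from this invocation, or scd-delivers a message set. -/
inductive CommEvent (M : Type*) where
  | broadcast (msg : M)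
  | broadcastReturn
  | deliver (ms : Finset M)

/-- The communication events of the `n` sequential processes, in the order of their occurrence. -/
abbrev CommHistory (n : ℕ) (M : Type*) := ℕ → Option (Fin n × CommEvent M)

namespace CommHistory

variable {n : ℕ} {M : Type*}

/-- At instant `τ`, process `i` invokes `scd_broadcast(msg)`. -/
def BroadcastsAt (h : CommHistory n M) (i : Fin n) (τ : ℕ) (msg : M) : Prop :=
  h τ = some (i, .broadcast msg)

/-- At instant `τ`, process `i` scd-delivers the message set `ms`. -/
def DeliversAt (h : CommHistory n M) (i : Fin n) (τ : ℕ) (ms : Finset M) : Prop :=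
  h τ = some (i, .deliver ms)

/-- Process `i` scd-delivers (at some time) a message set that contains `msg`. -/
def Delivers (h : CommHistory n M) (i : Fin n) (msg : M) : Prop :=
  ∃ τ ms, h.DeliversAt i τ ms ∧ msg ∈ ms

/-- The defining properties of SCD-broadcast, for a history in which `correct` is the set
of the non-faulty processes. -/
structure ScdProperties (h : CommHistory n M) (correct : Set (Fin n)) : Prop where
  /-- Message sets are not empty. -/
  nonempty : ∀ i τ ms, h.DeliversAt i τ ms → ms.Nonempty
  /-- Validity: a delivered message was broadcast (earlier) by some process. -/
  validity : ∀ i τ ms msg, h.DeliversAt i τ ms → msg ∈ ms →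
    ∃ j, ∃ σ < τ, h.BroadcastsAt j σ msg
  /-- Integrity: a message is delivered at most once by each process. -/
  integrity : ∀ i τ τ' ms ms' msg, h.DeliversAt i τ ms → h.DeliversAt i τ' ms' →
    msg ∈ ms → msg ∈ ms' → τ = τ'
  /-- MS-Ordering: if some process delivers first `msg` and later `msg'` in a different set,
  no process delivers first `msg'` and later `msg` in a different set. -/
  msOrdering : ∀ (msg msg' : M) (i : Fin n) (τ τ' : ℕ) (ms ms' : Finset M),
    h.DeliversAt i τ ms → msg ∈ ms → h.DeliversAt i τ' ms' → msg' ∈ ms' → τ < τ' → ms' ≠ ms →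
    ¬ ∃ (j : Fin n) (σ σ' : ℕ) (ns ns' : Finset M),
      h.DeliversAt j σ ns' ∧ msg' ∈ ns' ∧ h.DeliversAt j σ' ns ∧ msg ∈ ns ∧ σ < σ' ∧ ns ≠ ns'
  /-- Termination-1: if a non-faulty process scd-broadcasts a message, it returns from
  this invocation and scd-delivers a message set that contains the message. -/
  termination1 : ∀ i ∈ correct, ∀ τ msg, h.BroadcastsAt i τ msg →
    (∃ σ, τ < σ ∧ h σ = some (i, .broadcastReturn)) ∧ h.Delivers i msg
  /-- Termination-2: a message delivered by a non-faulty process is delivered by every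
  non-faulty process. -/
  termination2 : ∀ i ∈ correct, ∀ msg, h.Delivers i msg → ∀ j ∈ correct, h.Delivers j msg

/-- SCD-broadcast in a crash-prone system: the defining properties, together with the convention
that a faulty process behaves as a non-faulty one until it crashes. -/
structure ScdBroadcast (h : CommHistory n M) (correct : Set (Fin n)) : Prop where
  properties : h.ScdProperties correct
  /-- Every message delivered by a faulty process is delivered by the non-faulty processes. -/
  uniform : ∀ i msg, h.Delivers i msg → ∀ j ∈ correct, h.Delivers j msg
  /-- Until it crashes, a faulty process cannot be told apart from a slow non-faulty one: at every
  instant, what has occurred so far has a continuation without any faulty process that has the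
  defining properties. -/
  crashFreeContinuation : ∀ τ, ∃ h' : CommHistory n M,
    (∀ σ < τ, h' σ = h σ) ∧ h'.ScdProperties Set.univ

end CommHistory

/-! ### The snapshot algorithm -/

/-- Timestamps `⟨date, proc⟩` with the lexicographic order; `⊥` is the dummy identity `-`. -/
abbrev Timestamp (n : ℕ) := ℕ ×ₗ WithBot (Fin n)

/-- The contents `WRITE(r, v, ⟨date, j⟩)` and `SYNC(j)` of messages. -/
inductive Content (n m : ℕ) (V : Type*) where
  | write (r : Fin m) (v : V) (date : ℕ) (j : Fin n)
  | sync (j : Fin n)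

/-- A message. The tag is the rank of the message among those broadcast by its sender;
it makes all the messages different, and the algorithm never reads it. -/
structure Msg (n m : ℕ) (V : Type*) where
  content : Content n m V
  tag : ℕ

/-- The identity `j` carried by a message `WRITE(-, -, ⟨-, j⟩)` or `SYNC(j)`. -/
def Msg.proc {n m : ℕ} {V : Type*} (msg : Msg n m V) : Fin n :=
  match msg.content with
  | .write _ _ _ j => j
  | .sync j => j

/-- The operations of an MWMR snapshot object with `m` registers. -/
inductive Op (m : ℕ) (V : Type*) where
  | write (r : Fin m) (v : V)
  | snapshot

/-- The responses: a write returns no value, a snapshot returns an array. -/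
inductive Resp (m : ℕ) (V : Type*) where
  | ack
  | view (a : Fin m → V)

/-- The next line of the algorithm to be executed by a process. In `line2r`, `line6r` and `line9r`
the process has invoked `scd_broadcast` at the corresponding line and has not returned from it. -/
inductive Control (m : ℕ) (V : Type*) where
  | idle
  | line1 | line2 | line2r | line3 | line4
  | line5 (r : Fin m) (v : V)
  | line6 (r : Fin m) (v : V)
  | line6r (r : Fin m) (v : V)
  | line7 (r : Fin m) (v : V)
  | line8 (r : Fin m) (v : V)
  | line9 (r : Fin m) (v : V)
  | line9r (r : Fin m) (v : V)
  | line10 (r : Fin m) (v : V)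
  | crashed

/-- The state of a process: control point, the variables `done`, `reg[1..m]`, `tsa[1..m]` of the
algorithm, and the number of messages broadcast so far (only used to tag messages). -/
structure ProcState (n m : ℕ) (V : Type*) where
  control : Control m V
  done : Bool
  reg : Fin m → V
  tsa : Fin m → Timestamp n
  sent : ℕ

/-- Initial state, where `v₀` is the array of the initial values of the registers. -/
def ProcState.initial (n : ℕ) {m : ℕ} {V : Type*} (v₀ : Fin m → V) : ProcState n m V where
  control := .idle
  done := false
  reg := v₀
  tsa := fun _ => toLex (0, ⊥)
  sent := 0

/-- The events that occur at a process. -/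
inductive Act (n m : ℕ) (V : Type*) where
  /-- the application invokes an operation -/
  | invoke (op : Op m V)
  /-- a local statement of an operation -/
  | silent
  /-- the operation invokes `scd_broadcast` -/
  | broadcast (msg : Msg n m V)
  /-- the invocation of `scd_broadcast` returns -/
  | broadcastReturn
  /-- a message set is scd-delivered, and processed -/
  | deliver (ms : Finset (Msg n m V))
  /-- the operation returns -/
  | respond (res : Resp m V)
  /-- the process crashes -/
  | crash

/-- `WRITE(r, v, ts)` belongs to `ms`, and no message `WRITE(r, -, -)` of `ms` carries
a greater timestamp. -/
def IsGreatestWrite {n m : ℕ} {V : Type*} (ms : Finset (Msg n m V)) (r : Fin m) (v : V)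
    (ts : Timestamp n) : Prop :=
  (∃ msg ∈ ms, ∃ date j, msg.content = .write r v date j ∧ ts = toLex (date, (j : WithBot (Fin n))))
  ∧ ∀ msg ∈ ms, ∀ w date j, msg.content = .write r w date j →
      toLex (date, (j : WithBot (Fin n))) ≤ ts

/-- Processing of the scd-delivered message set `ms` by process `i` (lines 11 to 18). -/
structure Handles {n m : ℕ} {V : Type*} (i : Fin n) (ms : Finset (Msg n m V))
    (s s' : ProcState n m V) : Prop where
  control_eq : s'.control = s.control
  sent_eq : s'.sent = s.sent
  /-- Lines 11 to 17. -/
  registers : ∀ r,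
    (∃ v ts, IsGreatestWrite ms r v ts ∧ s.tsa r < ts ∧ s'.reg r = v ∧ s'.tsa r = ts) ∨
    ((∀ v ts, IsGreatestWrite ms r v ts → ¬ s.tsa r < ts) ∧
      s'.reg r = s.reg r ∧ s'.tsa r = s.tsa r)
  /-- Line 18. -/
  done_iff : s'.done = true ↔ s.done = true ∨ ∃ msg ∈ ms, msg.proc = i

/-- The code of process `i`: `LocalStep i s a s'` means that event `a` may occur at process `i` in
state `s`, and leads to state `s'`. -/
inductive LocalStep {n m : ℕ} {V : Type*} (i : Fin n) :
    ProcState n m V → Act n m V → ProcState n m V → Prop where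
  | invokeSnapshot (s : ProcState n m V) : s.control = .idle →
      LocalStep i s (.invoke .snapshot) { s with control := .line1 }
  | line1 (s : ProcState n m V) : s.control = .line1 →
      LocalStep i s .silent { s with control := .line2, done := false }
  | line2 (s : ProcState n m V) : s.control = .line2 →
      LocalStep i s (.broadcast ⟨.sync i, s.sent⟩)
        { s with control := .line2r, sent := s.sent + 1 }
  | line2r (s : ProcState n m V) : s.control = .line2r →
      LocalStep i s .broadcastReturn { s with control := .line3 }
  | line3 (s : ProcState n m V) : s.control = .line3 → s.done = true →
      LocalStep i s .silent { s with control := .line4 }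
  | line4 (s : ProcState n m V) : s.control = .line4 →
      LocalStep i s (.respond (.view s.reg)) { s with control := .idle }
  | invokeWrite (s : ProcState n m V) (r : Fin m) (v : V) : s.control = .idle →
      LocalStep i s (.invoke (.write r v)) { s with control := .line5 r v }
  | line5 (s : ProcState n m V) (r : Fin m) (v : V) : s.control = .line5 r v →
      LocalStep i s .silent { s with control := .line6 r v, done := false }
  | line6 (s : ProcState n m V) (r : Fin m) (v : V) : s.control = .line6 r v →
      LocalStep i s (.broadcast ⟨.sync i, s.sent⟩)
        { s with control := .line6r r v, sent := s.sent + 1 }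
  | line6r (s : ProcState n m V) (r : Fin m) (v : V) : s.control = .line6r r v →
      LocalStep i s .broadcastReturn { s with control := .line7 r v }
  | line7 (s : ProcState n m V) (r : Fin m) (v : V) : s.control = .line7 r v → s.done = true →
      LocalStep i s .silent { s with control := .line8 r v }
  | line8 (s : ProcState n m V) (r : Fin m) (v : V) : s.control = .line8 r v →
      LocalStep i s .silent { s with control := .line9 r v, done := false }
  | line9 (s : ProcState n m V) (r : Fin m) (v : V) : s.control = .line9 r v →
      LocalStep i s (.broadcast ⟨.write r v ((ofLex (s.tsa r)).1 + 1) i, s.sent⟩)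
        { s with control := .line9r r v, sent := s.sent + 1 }
  | line9r (s : ProcState n m V) (r : Fin m) (v : V) : s.control = .line9r r v →
      LocalStep i s .broadcastReturn { s with control := .line10 r v }
  | line10 (s : ProcState n m V) (r : Fin m) (v : V) : s.control = .line10 r v → s.done = true →
      LocalStep i s (.respond .ack) { s with control := .idle }
  | deliver (s s' : ProcState n m V) (ms : Finset (Msg n m V)) : s.control ≠ .crashed →
      Handles i ms s s' → LocalStep i s (.deliver ms) s'
  | crash (s : ProcState n m V) : s.control ≠ .crashed →
      LocalStep i s .crash { s with control := .crashed }

/-- The statements whose execution is up to the process itself (neither to the application nor to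
SCD-broadcast). -/
def Act.IsOwn {n m : ℕ} {V : Type*} : Act n m V → Prop
  | .silent => True
  | .broadcast _ => True
  | .respond _ => True
  | _ => False

/-- The interaction of an event with SCD-broadcast, if any. -/
def Act.comm {n m : ℕ} {V : Type*} : Act n m V → Option (CommEvent (Msg n m V))
  | .broadcast msg => some (.broadcast msg)
  | .broadcastReturn => some .broadcastReturn
  | .deliver ms => some (.deliver ms)
  | _ => none

/-! ### Runs -/

/-- `state τ i` is the state of process `i` just before instant `τ`; `event τ` is the event that
occurs at instant `τ`, if any, with the process at which it occurs. -/
structure Execution (n m : ℕ) (V : Type*) where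
  state : ℕ → Fin n → ProcState n m V
  event : ℕ → Option (Fin n × Act n m V)

namespace Execution

variable {n m : ℕ} {V : Type*}

/-- The processes that crash. -/
def faulty (E : Execution n m V) : Set (Fin n) := {i | ∃ τ, E.event τ = some (i, .crash)}

/-- The non-faulty processes. -/
def correct (E : Execution n m V) : Set (Fin n) := E.faultyᶜ

/-- The communication history of an execution. -/
def comm (E : Execution n m V) : CommHistory n (Msg n m V) := fun τ =>
  match E.event τ with
  | none => none
  | some (i, a) => a.comm.map fun c => (i, c)

/-- `E` is a run of the algorithm, with initial values `v₀`, in the asynchronous message-passing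
model enriched with SCD-broadcast in which at most `t` processes crash. -/
structure IsRun (E : Execution n m V) (t : ℕ) (v₀ : Fin m → V) : Prop where
  initial : ∀ i, E.state 0 i = ProcState.initial n v₀
  stutter : ∀ τ, E.event τ = none → E.state (τ + 1) = E.state τ
  step : ∀ τ i a, E.event τ = some (i, a) →
    LocalStep i (E.state τ i) a (E.state (τ + 1) i) ∧
      ∀ j, j ≠ i → E.state (τ + 1) j = E.state τ j
  /-- A non-faulty process that can execute a statement eventually does so. -/
  progress : ∀ i ∈ E.correct, ∀ τ,
    (∃ a s', a.IsOwn ∧ LocalStep i (E.state τ i) a s') →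
    ∃ σ, τ ≤ σ ∧ ∃ a, a.IsOwn ∧ E.event σ = some (i, a)
  crashes : E.faulty.ncard ≤ t
  scd : E.comm.ScdBroadcast E.correct

/-! ### The MWMR snapshot object

An operation of an execution is identified with the instant of its invocation. -/

/-- Process `i` invokes operation `op` at instant `τ`. -/
def Invokes (E : Execution n m V) (i : Fin n) (τ : ℕ) (op : Op m V) : Prop :=
  E.event τ = some (i, .invoke op)

/-- The operation `op` invoked by process `i` at instant `τ` returns `res` at instant `σ`. -/
def Completes (E : Execution n m V) (i : Fin n) (τ : ℕ) (op : Op m V) (σ : ℕ) (res : Resp m V) :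
    Prop :=
  E.Invokes i τ op ∧ τ < σ ∧ E.event σ = some (i, .respond res) ∧
    ∀ ρ res', τ < ρ → ρ < σ → E.event ρ ≠ some (i, .respond res')

/-- Every operation invoked by a non-faulty process terminates. -/
def WaitFree (E : Execution n m V) : Prop :=
  ∀ i ∈ E.correct, ∀ τ op, E.Invokes i τ op → ∃ σ res, E.Completes i τ op σ res

/-- The operation `τ` is a write of `v` in register `r`. -/
def WritesOp (E : Execution n m V) (τ : ℕ) (r : Fin m) (v : V) : Prop :=
  ∃ i, E.Invokes i τ (.write r v)

/-- In the sequence of the operations of `L`, in which `pos` gives the positions, `v` is the value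
of register `r` when the operation `τ` of `L` takes place: the value written by the closest preceding
write of `r`, or the initial value if there is none. -/
def ValueBefore (E : Execution n m V) (v₀ : Fin m → V) (L : Set ℕ) (pos : ℕ → ℕ) (τ : ℕ)
    (r : Fin m) (v : V) : Prop :=
  (∃ ρ ∈ L, E.WritesOp ρ r v ∧ pos ρ < pos τ ∧
    ∀ ρ' ∈ L, ∀ w, E.WritesOp ρ' r w → pos ρ' < pos τ → pos ρ' ≤ pos ρ) ∨
  (v = v₀ r ∧ ∀ ρ' ∈ L, ∀ w, E.WritesOp ρ' r w → ¬ pos ρ' < pos τ)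

/-- Linearizability with respect to the sequential specification of the MWMR snapshot object. -/
def Linearizable (E : Execution n m V) (v₀ : Fin m → V) : Prop :=
  ∃ (L : Set ℕ) (pos : ℕ → ℕ),
    -- `L` contains all the completed operations, and possibly some of the pending ones
    (∀ τ ∈ L, ∃ i op, E.Invokes i τ op) ∧
    (∀ i τ op σ res, E.Completes i τ op σ res → τ ∈ L) ∧
    -- the operations of `L` are totally ordered in a sequence
    Set.InjOn pos L ∧
    -- the sequence respects the real-time order
    (∀ i τ op σ res, E.Completes i τ op σ res → ∀ τ' ∈ L, σ < τ' → pos τ < pos τ') ∧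
    -- the sequence belongs to the sequential specification
    (∀ i τ r v σ res, E.Completes i τ (.write r v) σ res → res = .ack) ∧
    (∀ i τ σ res, E.Completes i τ .snapshot σ res →
      ∃ a, res = .view a ∧ ∀ r, E.ValueBefore v₀ L pos τ r (a r))

/-- The values of the arrays `tsa` at the end of the processing of a message set. -/
def tsaValues (E : Execution n m V) : Set (Fin m → Timestamp n) :=
  {A | ∃ i τ ms, E.event τ = some (i, .deliver ms) ∧ A = (E.state (τ + 1) i).tsa}

end Execution

end ScdSnapshot

/-! Everything rests on one fact: the sets of messages delivered so far, at all processes and all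
instants, form a chain for inclusion (`ScdBroadcast.deliveredBefore_total`). If `i` had delivered
`a` but not `b`, and `j` had delivered `b` but not `a`, a crash-free continuation would make `i`
deliver `b` and `j` deliver `a` later, against MS-Ordering. These sets are finite, so comparing
their sizes amounts to comparing them.

The entry `tsa[r]` is the greatest timestamp of a `WRITE(r,-,-)` in the delivered set, or the
initial one (`registers_eq`, `le_tsa`). It depends on that set alone and grows with it, so the
arrays `tsa` form a chain.

For linearizability, a snapshot is placed at the size of the delivered set when it returns, and a
write with timestamp `ts` at the least size of a delivered set for which `tsa[r]` reaches `ts`. At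
equal sizes writes come before snapshots and are sorted by timestamp. A write of `r` then precedes a
snapshot iff `ts ≤ tsa[r]` at its return (`write_lt_snapshot_iff`), and `reg[r]` holds the value
with the greatest such timestamp. Real time is respected because a completed operation lies at most
at the size of what its process has delivered on return, whereas a later operation lies above the
delivery of a message that it broadcasts itself (`ncard_delivered_lt_of_isKey`). For a write this
message is the `SYNC`, which is why a write begins with a synchronization.

Wait-freedom: at a waiting point, `done` is true iff no message of the process is pending
(`pendingInv`), and Termination-1 delivers pending messages. Each statement raises the bounded
`Control.rank`, so the operation returns. -/

namespace ScdSnapshot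

/-! ### Delivered sets form a chain -/

namespace CommHistory

variable {n : ℕ} {M : Type*} {h : CommHistory n M} {correct : Set (Fin n)}

/-- The messages that process `i` scd-delivers before instant `x`. -/
def deliveredBefore (h : CommHistory n M) (i : Fin n) (x : ℕ) : Set M :=
  {msg | ∃ ρ < x, ∃ ms, h.DeliversAt i ρ ms ∧ msg ∈ ms}

theorem deliveredBefore_finite (h : CommHistory n M) (i : Fin n) (x : ℕ) :
    (h.deliveredBefore i x).Finite := by
  refine Set.Finite.subset (Set.Finite.biUnion (Set.finite_Iio x)
    (t := fun ρ => {msg | ∃ ms, h.DeliversAt i ρ ms ∧ msg ∈ ms}) fun ρ _ => ?_) ?_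
  · by_cases H : ∃ ms, h.DeliversAt i ρ ms
    · obtain ⟨ms, H⟩ := H
      refine ms.finite_toSet.subset ?_
      rintro msg ⟨ms', H', hm⟩
      unfold DeliversAt at H H'
      rw [H] at H'
      cases H'
      exact hm
    · convert Set.finite_empty
      ext msg
      simp only [Set.mem_ofPred_eq, Set.mem_empty_iff_false, iff_false]
      rintro ⟨ms, h1, -⟩
      exact H ⟨ms, h1⟩
  · rintro msg ⟨ρ, hρ, H⟩
    exact Set.mem_biUnion (show ρ ∈ Set.Iio x from hρ) H

/-- The sets of messages delivered by the processes over time are totally ordered by inclusion. -/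
theorem ScdBroadcast.deliveredBefore_total (hS : h.ScdBroadcast correct) (i j : Fin n) (x y : ℕ) :
    h.deliveredBefore i x ⊆ h.deliveredBefore j y ∨
      h.deliveredBefore j y ⊆ h.deliveredBefore i x := by
  by_contra hcon
  rw [not_or, Set.not_subset, Set.not_subset] at hcon
  obtain ⟨⟨a, ⟨ρ, hρ, ms, hms, ha⟩, ha'⟩, ⟨b, ⟨σ, hσ, ns, hns, hb⟩, hb'⟩⟩ := hcon
  -- In the run itself `i` or `j` may crash before delivering the missing message; in `h'` both must
  -- deliver it, and by `key` only after the instants considered.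
  obtain ⟨h', heq, hP⟩ := hS.crashFreeContinuation (max x y)
  have key : ∀ (l : Fin n) (z : ℕ), z ≤ max x y → ∀ c, c ∉ h.deliveredBefore l z →
      ∀ τ ks, h'.DeliversAt l τ ks → c ∈ ks → z ≤ τ := by
    intro l z hz c hc τ ks hd hm
    by_contra hlt
    refine hc ⟨τ, by omega, ks, ?_, hm⟩
    unfold DeliversAt at hd ⊢
    rw [← heq τ (by omega)]
    exact hd
  have hmsx : h'.DeliversAt i ρ ms := by
    unfold DeliversAt at hms ⊢
    rw [heq ρ (by omega)]
    exact hms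
  have hnsx : h'.DeliversAt j σ ns := by
    unfold DeliversAt at hns ⊢
    rw [heq σ (by omega)]
    exact hns
  obtain ⟨ρ', ms', hms', hb2⟩ := hP.termination2 j trivial b ⟨σ, ns, hnsx, hb⟩ i trivial
  obtain ⟨σ', ns', hns', ha2⟩ := hP.termination2 i trivial a ⟨ρ, ms, hmsx, ha⟩ j trivial
  have h1 := key i x (le_max_left _ _) b hb' ρ' ms' hms' hb2
  have h2 := key j y (le_max_right _ _) a ha' σ' ns' hns' ha2
  refine hP.msOrdering a b i ρ ρ' ms ms' hmsx ha hms' hb2 (by omega) ?_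
    ⟨j, σ, σ', ns', ns, hnsx, hb, hns', ha2, by omega, ?_⟩
  · rintro rfl
    exact hb' ⟨ρ, hρ, ms', hms, hb2⟩
  · rintro rfl
    exact ha' ⟨σ, hσ, ns', hns, ha2⟩

theorem ScdBroadcast.deliveredBefore_ssubset (hS : h.ScdBroadcast correct) {i j : Fin n} {x y : ℕ}
    {msg : M} (hj : msg ∈ h.deliveredBefore j y) (hi : msg ∉ h.deliveredBefore i x) :
    h.deliveredBefore i x ⊂ h.deliveredBefore j y := by
  rcases hS.deliveredBefore_total i j x y with H | H
  · exact ⟨H, fun H' => hi (H' hj)⟩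
  · exact absurd (H hj) hi

/-- In a chain of finite sets, cardinality decides inclusion. This is what allows sizes of delivered
sets to serve as linearization points. -/
theorem ScdBroadcast.deliveredBefore_subset_of_ncard_le (hS : h.ScdBroadcast correct) {i j : Fin n}
    {x y : ℕ} (hle : (h.deliveredBefore i x).ncard ≤ (h.deliveredBefore j y).ncard) :
    h.deliveredBefore i x ⊆ h.deliveredBefore j y := by
  rcases hS.deliveredBefore_total i j x y with H | H
  · exact H
  · exact (Set.eq_of_subset_of_ncard_le H hle (h.deliveredBefore_finite i x)).ge

end CommHistory

/-! ### Control points, pending messages and the variable `done` -/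

/-- The operation in which a process at the given control point is engaged. -/
def Control.op {m : ℕ} {V : Type*} : Control m V → Option (Op m V)
  | .line1 | .line2 | .line2r | .line3 | .line4 => some .snapshot
  | .line5 r v | .line6 r v | .line6r r v | .line7 r v | .line8 r v | .line9 r v | .line9r r v
  | .line10 r v => some (.write r v)
  | .idle | .crashed => none

/-- The number of lines of the current operation that have been executed. -/
def Control.rank {m : ℕ} {V : Type*} : Control m V → ℕ
  | .idle | .crashed => 0
  | .line1 | .line5 _ _ => 1
  | .line2 | .line6 _ _ => 2
  | .line2r | .line6r _ _ => 3
  | .line3 | .line7 _ _ => 4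
  | .line4 | .line8 _ _ => 5
  | .line9 _ _ => 6
  | .line9r _ _ => 7
  | .line10 _ _ => 8

/-- The relation between the control point of a process, its variable `done`, and the set of its
messages that it has broadcast and not yet delivered. -/
def Control.PendingInv {m : ℕ} {V M : Type*} (c : Control m V) (done : Bool) (U : Set M) : Prop :=
  match c with
  | .idle | .line1 | .line4 | .line5 _ _ | .line8 _ _ => U = ∅
  | .line2 | .line6 _ _ | .line9 _ _ => U = ∅ ∧ done = false
  | .line2r | .line3 | .line6r _ _ | .line7 _ _ | .line9r _ _ | .line10 _ _ =>
    U.Subsingleton ∧ (done = true ↔ U = ∅)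
  | .crashed => True

/-- Where the process waits, at most one message is pending, so a delivered set that meets `U`
empties it; this is exactly when `done` is raised. -/
theorem Control.PendingInv.diff {m : ℕ} {V M : Type*} {c : Control m V} {done done' : Bool}
    {U : Set M} {ms : Set M} (h : c.PendingInv done U)
    (hd : done' = true ↔ done = true ∨ ∃ msg ∈ ms, msg ∈ U) : c.PendingInv done' (U \ ms) := by
  have h1 : U = ∅ → U \ ms = ∅ := by rintro rfl; simp
  have h2 : U = ∅ ∧ done = false → U \ ms = ∅ ∧ done' = false := by
    rintro ⟨rfl, rfl⟩
    simpa using hd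
  have h3 : U.Subsingleton ∧ (done = true ↔ U = ∅) →
      (U \ ms).Subsingleton ∧ (done' = true ↔ U \ ms = ∅) := by
    rintro ⟨hs, he⟩
    refine ⟨hs.anti Set.sdiff_subset, ?_⟩
    rw [hd, he]
    constructor
    · rintro (rfl | ⟨msg, hm, hU⟩)
      · simp
      · ext b
        simp only [Set.mem_sdiff, Set.mem_empty_iff_false, iff_false, not_and, not_not]
        intro hb
        rwa [hs hb hU]
    · intro hem
      rcases U.eq_empty_or_nonempty with hU | ⟨b, hb⟩
      · exact Or.inl hU
      · refine Or.inr ⟨b, ?_, hb⟩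
        by_contra hb'
        exact (hem ▸ (⟨hb, hb'⟩ : b ∈ U \ ms) : b ∈ (∅ : Set M))
  cases c
  case crashed => trivial
  all_goals first | exact h1 h | exact h2 h | exact h3 h

namespace Execution

variable {n m t : ℕ} {V : Type*} {v₀ : Fin m → V} {E : Execution n m V}

theorem comm_broadcastsAt {i : Fin n} {τ : ℕ} {msg : Msg n m V} :
    E.comm.BroadcastsAt i τ msg ↔ E.event τ = some (i, .broadcast msg) := by
  unfold CommHistory.BroadcastsAt comm
  rcases E.event τ with _ | ⟨j, a⟩
  · simp
  · cases a <;> simp [Act.comm]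

theorem comm_deliversAt {i : Fin n} {τ : ℕ} {ms : Finset (Msg n m V)} :
    E.comm.DeliversAt i τ ms ↔ E.event τ = some (i, .deliver ms) := by
  unfold CommHistory.DeliversAt comm
  rcases E.event τ with _ | ⟨j, a⟩
  · simp
  · cases a <;> simp [Act.comm]

theorem comm_broadcastReturn {i : Fin n} {τ : ℕ} :
    E.comm τ = some (i, .broadcastReturn) ↔ E.event τ = some (i, .broadcastReturn) := by
  unfold comm
  rcases E.event τ with _ | ⟨j, a⟩
  · simp
  · cases a <;> simp [Act.comm]

/-- The messages that process `i` scd-delivers before instant `x`. -/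
def delivered (E : Execution n m V) (i : Fin n) (x : ℕ) : Set (Msg n m V) :=
  E.comm.deliveredBefore i x

/-- The messages that process `i` broadcasts before instant `x` and does not deliver before `x`. -/
def pending (E : Execution n m V) (i : Fin n) (x : ℕ) : Set (Msg n m V) :=
  {msg | (∃ ρ < x, E.event ρ = some (i, .broadcast msg)) ∧ msg ∉ E.delivered i x}

theorem mem_delivered {i : Fin n} {x : ℕ} {msg : Msg n m V} :
    msg ∈ E.delivered i x ↔ ∃ ρ < x, ∃ ms, E.event ρ = some (i, .deliver ms) ∧ msg ∈ ms := by
  simp only [delivered, CommHistory.deliveredBefore, comm_deliversAt, Set.mem_ofPred_eq]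

theorem delivered_zero (i : Fin n) : E.delivered i 0 = ∅ := by
  ext msg
  simp [mem_delivered]

theorem delivered_mono (i : Fin n) : Monotone (E.delivered i) := by
  intro x y hxy msg h
  rw [mem_delivered] at h ⊢
  obtain ⟨ρ, h1, h2⟩ := h
  exact ⟨ρ, by omega, h2⟩

theorem delivered_succ_of_deliver {i : Fin n} {x : ℕ} {ms : Finset (Msg n m V)}
    (h : E.event x = some (i, .deliver ms)) : E.delivered i (x + 1) = E.delivered i x ∪ ms := by
  ext msg
  simp only [Set.mem_union, mem_delivered, Finset.mem_coe]
  constructor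
  · rintro ⟨ρ, h1, ms', h2, h3⟩
    rcases Nat.lt_succ_iff_lt_or_eq.1 h1 with h1 | rfl
    · exact Or.inl ⟨ρ, h1, ms', h2, h3⟩
    · rw [h] at h2
      cases h2
      exact Or.inr h3
  · rintro (⟨ρ, h1, h2⟩ | h1)
    · exact ⟨ρ, by omega, h2⟩
    · exact ⟨x, by omega, ms, h, h1⟩

theorem delivered_succ_of_ne {i : Fin n} {x : ℕ}
    (h : ∀ ms, E.event x ≠ some (i, .deliver ms)) : E.delivered i (x + 1) = E.delivered i x := by
  refine Set.Subset.antisymm ?_ (delivered_mono i (by omega))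
  intro msg
  rw [mem_delivered, mem_delivered]
  rintro ⟨ρ, h1, ms', h2, h3⟩
  rcases Nat.lt_succ_iff_lt_or_eq.1 h1 with h1 | rfl
  · exact ⟨ρ, h1, ms', h2, h3⟩
  · exact absurd h2 (h ms')

namespace IsRun

theorem step_cases (hE : E.IsRun t v₀) (i : Fin n) (τ : ℕ) :
    (E.state (τ + 1) i = E.state τ i ∧ ∀ a, E.event τ ≠ some (i, a)) ∨
      ∃ a, E.event τ = some (i, a) ∧ LocalStep i (E.state τ i) a (E.state (τ + 1) i) := by
  rcases h : E.event τ with _ | ⟨j, a⟩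
  · left
    rw [hE.stutter τ h]
    simp
  · obtain ⟨h1, h2⟩ := hE.step τ j a h
    by_cases hij : i = j
    · subst hij
      exact Or.inr ⟨a, rfl, h1⟩
    · refine Or.inl ⟨h2 i hij, fun b hb => ?_⟩
      cases hb
      exact hij rfl

theorem localStep (hE : E.IsRun t v₀) {i : Fin n} {τ : ℕ} {a : Act n m V}
    (h : E.event τ = some (i, a)) : LocalStep i (E.state τ i) a (E.state (τ + 1) i) :=
  (hE.step τ i a h).1

/-- A property of the states of process `i` that holds from the beginning, and is preserved by its
steps, always holds. -/
theorem induction (hE : E.IsRun t v₀) (i : Fin n) (P : ℕ → ProcState n m V → Prop) (x₀ : ℕ)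
    (h0 : P x₀ (E.state x₀ i))
    (hs : ∀ x ≥ x₀, (∀ a, E.event x ≠ some (i, a)) → P x (E.state x i) → P (x + 1) (E.state x i))
    (hl : ∀ x ≥ x₀, ∀ a s', E.event x = some (i, a) → LocalStep i (E.state x i) a s' →
      E.state (x + 1) i = s' → P x (E.state x i) → P (x + 1) s') :
    ∀ x ≥ x₀, P x (E.state x i) := by
  intro x hx
  induction x, hx using Nat.le_induction with
  | base => exact h0
  | succ x hx ih =>
    rcases hE.step_cases i x with ⟨h1, h2⟩ | ⟨a, h1, h2⟩
    · rw [h1]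
      exact hs x hx h2 ih
    · exact hl x hx a _ h1 h2 rfl ih

theorem sent_mono (hE : E.IsRun t v₀) (i : Fin n) : Monotone fun x => (E.state x i).sent := by
  refine monotone_nat_of_le_succ fun x => ?_
  rcases hE.step_cases i x with ⟨h1, -⟩ | ⟨a, -, h2⟩
  · rw [h1]
  · generalize E.state (x + 1) i = s' at h2
    cases h2
    case deliver h => exact h.sent_eq.ge
    all_goals simp

theorem broadcast_spec (hE : E.IsRun t v₀) {i : Fin n} {x : ℕ} {msg : Msg n m V}
    (h : E.event x = some (i, .broadcast msg)) :
    msg.proc = i ∧ msg.tag = (E.state x i).sent ∧ (E.state (x + 1) i).sent = msg.tag + 1 := by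
  have h2 := hE.localStep h
  generalize E.state (x + 1) i = s' at h2
  cases h2 <;> simp [Msg.proc]

/-- The tag of a message is the value of a counter that the broadcast itself increments, and the
message names its sender. -/
theorem broadcast_unique (hE : E.IsRun t v₀) {i j : Fin n} {x y : ℕ} {msg : Msg n m V}
    (h : E.event x = some (i, .broadcast msg)) (h' : E.event y = some (j, .broadcast msg)) :
    x = y := by
  obtain ⟨h1, h2, h3⟩ := hE.broadcast_spec h
  obtain ⟨h1', h2', h3'⟩ := hE.broadcast_spec h'
  obtain rfl : i = j := h1.symm.trans h1'
  rcases lt_trichotomy x y with hl | hl | hl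
  · have := hE.sent_mono i (show x + 1 ≤ y from hl)
    simp only at this
    omega
  · exact hl
  · have := hE.sent_mono i (show y + 1 ≤ x from hl)
    simp only at this
    omega

theorem exists_broadcast_of_mem_delivered (hE : E.IsRun t v₀) {i : Fin n} {x : ℕ}
    {msg : Msg n m V} (h : msg ∈ E.delivered i x) :
    ∃ ρ < x, E.event ρ = some (msg.proc, .broadcast msg) := by
  obtain ⟨ρ, h1, ms, h2, h3⟩ := h
  obtain ⟨j, σ, hσ, hb⟩ := hE.scd.properties.validity i ρ ms msg h2 h3
  rw [comm_broadcastsAt] at hb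
  have := (hE.broadcast_spec hb).1
  subst this
  exact ⟨σ, by omega, hb⟩

theorem notMem_delivered_of_broadcast (hE : E.IsRun t v₀) {i j : Fin n} {x y : ℕ}
    {msg : Msg n m V} (h : E.event y = some (j, .broadcast msg)) (hxy : x ≤ y) :
    msg ∉ E.delivered i x := by
  intro hm
  obtain ⟨ρ, hρ, hb⟩ := hE.exists_broadcast_of_mem_delivered hm
  have := hE.broadcast_unique h hb
  omega

theorem pending_succ_of_broadcast (hE : E.IsRun t v₀) {i : Fin n} {x : ℕ} {msg : Msg n m V}
    (h : E.event x = some (i, .broadcast msg)) : E.pending i (x + 1) = insert msg (E.pending i x) := by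
  have hd : E.delivered i (x + 1) = E.delivered i x := delivered_succ_of_ne (by simp [h])
  ext b
  simp only [pending, hd, Set.mem_ofPred_eq, Set.mem_insert_iff]
  constructor
  · rintro ⟨⟨ρ, h1, h2⟩, h3⟩
    rcases Nat.lt_succ_iff_lt_or_eq.1 h1 with h1 | rfl
    · exact Or.inr ⟨⟨ρ, h1, h2⟩, h3⟩
    · rw [h] at h2
      cases h2
      exact Or.inl rfl
  · rintro (rfl | ⟨⟨ρ, h1, h2⟩, h3⟩)
    · exact ⟨⟨x, by omega, h⟩, hE.notMem_delivered_of_broadcast h le_rfl⟩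
    · exact ⟨⟨ρ, by omega, h2⟩, h3⟩

theorem pending_succ_of_deliver {i : Fin n} {x : ℕ} {ms : Finset (Msg n m V)}
    (h : E.event x = some (i, .deliver ms)) : E.pending i (x + 1) = E.pending i x \ ms := by
  ext b
  simp only [pending, delivered_succ_of_deliver h, Set.mem_ofPred_eq, Set.mem_sdiff, Set.mem_union,
    not_or, and_assoc]
  refine and_congr_left fun _ => ⟨?_, ?_⟩
  · rintro ⟨ρ, h1, h2⟩
    rcases Nat.lt_succ_iff_lt_or_eq.1 h1 with h1 | rfl
    · exact ⟨ρ, h1, h2⟩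
    · rw [h] at h2
      cases h2
  · rintro ⟨ρ, h1, h2⟩
    exact ⟨ρ, by omega, h2⟩

theorem pending_succ_of_ne {i : Fin n} {x : ℕ} (h : ∀ ms, E.event x ≠ some (i, .deliver ms))
    (h' : ∀ msg, E.event x ≠ some (i, .broadcast msg)) : E.pending i (x + 1) = E.pending i x := by
  ext b
  simp only [pending, delivered_succ_of_ne h, Set.mem_ofPred_eq]
  refine and_congr_left fun _ => ⟨?_, ?_⟩
  · rintro ⟨ρ, h1, h2⟩
    rcases Nat.lt_succ_iff_lt_or_eq.1 h1 with h1 | rfl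
    · exact ⟨ρ, h1, h2⟩
    · exact absurd h2 (h' b)
  · rintro ⟨ρ, h1, h2⟩
    exact ⟨ρ, by omega, h2⟩

/-- Validity provides an earlier broadcast and Integrity excludes an earlier delivery. Hence the
test on `msg.proc` that sets `done` detects the pending messages of the process. -/
theorem mem_pending_of_deliver (hE : E.IsRun t v₀) {i : Fin n} {x : ℕ} {ms : Finset (Msg n m V)}
    (h : E.event x = some (i, .deliver ms)) {msg : Msg n m V} (hm : msg ∈ ms) (hp : msg.proc = i) :
    msg ∈ E.pending i x := by
  subst hp
  constructor
  · obtain ⟨j, σ, hσ, hb⟩ := hE.scd.properties.validity _ x ms msg (comm_deliversAt.2 h) hm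
    rw [comm_broadcastsAt] at hb
    refine ⟨σ, hσ, ?_⟩
    rw [hb, (hE.broadcast_spec hb).1]
  · rintro ⟨ρ, hρ, ms', h1, h2⟩
    have := hE.scd.properties.integrity _ x ρ ms ms' msg (comm_deliversAt.2 h) h1 hm h2
    omega

/-- This gives the meaning of waiting for `done`: past the wait, nothing broadcast by the process is
left undelivered to it. -/
theorem pendingInv (hE : E.IsRun t v₀) (i : Fin n) (x : ℕ) :
    (E.state x i).control.PendingInv (E.state x i).done (E.pending i x) := by
  refine hE.induction i (fun x s => s.control.PendingInv s.done (E.pending i x)) 0 ?_ ?_ ?_ x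
    (Nat.zero_le x)
  · rw [hE.initial]
    simp [ProcState.initial, Control.PendingInv, pending]
  · intro x _ h ih
    rw [pending_succ_of_ne (fun _ => h _) (fun _ => h _)]
    exact ih
  · intro x _ a s' he hl hs ih
    clear hs
    generalize E.state x i = s at *
    cases hl
    case deliver ms hc hh =>
      rw [pending_succ_of_deliver he, hh.control_eq]
      refine ih.diff ?_
      rw [hh.done_iff]
      refine or_congr_right (exists_congr fun msg => and_congr_right fun hm => ?_)
      refine ⟨hE.mem_pending_of_deliver he hm, ?_⟩
      rintro ⟨⟨ρ, -, hb⟩, -⟩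
      exact (hE.broadcast_spec hb).1
    case crash => trivial
    case line2 h | line6 h | line9 h =>
      rw [hE.pending_succ_of_broadcast he]
      simp only [h, Control.PendingInv] at ih ⊢
      simp [ih.1, ih.2]
    all_goals
      rw [pending_succ_of_ne (by simp [he]) (by simp [he])]
      simp_all [Control.PendingInv]

end IsRun

end Execution

/-! ### Timestamps and registers as functions of the delivered set -/

/-- The timestamp carried by a message, if it is a write. -/
def Msg.timestamp {n m : ℕ} {V : Type*} (msg : Msg n m V) : Timestamp n :=
  match msg.content with
  | .write _ _ date j => toLex (date, (j : WithBot (Fin n)))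
  | .sync _ => toLex (0, ⊥)

theorem exists_isGreatestWrite {n m : ℕ} {V : Type*} {ms : Finset (Msg n m V)} {r : Fin m}
    {msg : Msg n m V} {w : V} {date : ℕ} {j : Fin n} (hm : msg ∈ ms)
    (hc : msg.content = .write r w date j) : ∃ v ts, IsGreatestWrite ms r v ts := by
  classical
  obtain ⟨b, hb, hmax⟩ := Finset.exists_max_image
    (ms.filter fun b => ∃ v d k, b.content = .write r v d k) Msg.timestamp
    ⟨msg, Finset.mem_filter.2 ⟨hm, _, _, _, hc⟩⟩
  obtain ⟨hb, v, d, k, hbc⟩ := Finset.mem_filter.1 hb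
  refine ⟨v, toLex (d, k), ⟨b, hb, d, k, hbc, rfl⟩, fun c hcm u d' k' hcc => ?_⟩
  have := hmax c (Finset.mem_filter.2 ⟨hcm, _, _, _, hcc⟩)
  simpa only [Msg.timestamp, hcc, hbc] using this

theorem Timestamp.initial_le {n : ℕ} (ts : Timestamp n) : toLex (0, ⊥) ≤ ts :=
  bot_le (α := Timestamp n)

theorem Timestamp.lt_succ_date {n : ℕ} (ts : Timestamp n) (p : WithBot (Fin n)) :
    ts < toLex ((ofLex ts).1 + 1, p) := by
  rw [Prod.Lex.lt_iff]
  exact Or.inl (Nat.lt_succ_self _)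

/-- The effect of the processing of a message set on the timestamp of a register. -/
theorem Handles.le_tsa {n m : ℕ} {V : Type*} {i : Fin n} {ms : Finset (Msg n m V)}
    {s s' : ProcState n m V} (h : Handles i ms s s') {r : Fin m} {msg : Msg n m V} {w : V}
    {date : ℕ} {j : Fin n} (hm : msg ∈ ms) (hc : msg.content = .write r w date j) :
    toLex (date, (j : WithBot (Fin n))) ≤ s'.tsa r := by
  obtain ⟨v, ts, hg⟩ := exists_isGreatestWrite hm hc
  rcases h.registers r with ⟨v', ts', hg', -, -, h4⟩ | ⟨h1, -, h3⟩
  · rw [h4]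
    exact hg'.2 _ hm _ _ _ hc
  · rw [h3]
    exact (hg.2 _ hm _ _ _ hc).trans (not_lt.1 (h1 v ts hg))

theorem Handles.tsa_le {n m : ℕ} {V : Type*} {i : Fin n} {ms : Finset (Msg n m V)}
    {s s' : ProcState n m V} (h : Handles i ms s s') (r : Fin m) : s.tsa r ≤ s'.tsa r := by
  rcases h.registers r with ⟨v', ts', -, h2, -, h4⟩ | ⟨-, -, h3⟩
  · rw [h4]
    exact h2.le
  · rw [h3]

namespace Execution

variable {n m t : ℕ} {V : Type*} {v₀ : Fin m → V} {E : Execution n m V}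

namespace IsRun

/-- Together with `le_tsa`, this makes `tsa[r]` a maximum over the delivered set, whatever the
process and the grouping of messages into deliveries. -/
theorem registers_eq (hE : E.IsRun t v₀) (i : Fin n) (x : ℕ) (r : Fin m) :
    ((E.state x i).tsa r = toLex (0, ⊥) ∧ (E.state x i).reg r = v₀ r) ∨
      ∃ msg ∈ E.delivered i x, ∃ d j, msg.content = .write r ((E.state x i).reg r) d j ∧
        (E.state x i).tsa r = toLex (d, (j : WithBot (Fin n))) := by
  refine hE.induction i (fun x s => (s.tsa r = toLex (0, ⊥) ∧ s.reg r = v₀ r) ∨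
      ∃ msg ∈ E.delivered i x, ∃ d j, msg.content = .write r (s.reg r) d j ∧
        s.tsa r = toLex (d, (j : WithBot (Fin n)))) 0 ?_ ?_ ?_ x (Nat.zero_le x)
  · rw [hE.initial]
    exact Or.inl ⟨rfl, rfl⟩
  · intro x _ h ih
    rw [delivered_succ_of_ne (fun _ => h _)]
    exact ih
  · intro x _ a s' he hl hs ih
    clear hs
    generalize E.state x i = s at *
    cases hl
    case deliver ms hc hh =>
      rw [delivered_succ_of_deliver he]
      rcases hh.registers r with ⟨v, ts, hg, -, h3, h4⟩ | ⟨-, h3, h4⟩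
      · obtain ⟨⟨msg, hm, d, j, hc, hts⟩, -⟩ := hg
        refine Or.inr ⟨msg, Or.inr hm, d, j, ?_, ?_⟩
        · rw [h3, hc]
        · rw [h4, hts]
      · rw [h3, h4]
        refine ih.imp_right ?_
        rintro ⟨msg, hm, H⟩
        exact ⟨msg, Or.inl hm, H⟩
    all_goals
      rw [delivered_succ_of_ne (by simp [he])]
      exact ih

theorem le_tsa (hE : E.IsRun t v₀) {i : Fin n} {x : ℕ} {r : Fin m} {msg : Msg n m V}
    (hm : msg ∈ E.delivered i x) {w : V} {d : ℕ} {j : Fin n}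
    (hc : msg.content = .write r w d j) :
    toLex (d, (j : WithBot (Fin n))) ≤ (E.state x i).tsa r := by
  revert hm
  refine hE.induction i (fun x s => msg ∈ E.delivered i x →
    toLex (d, (j : WithBot (Fin n))) ≤ s.tsa r) 0 ?_ ?_ ?_ x (Nat.zero_le x)
  · simp [delivered_zero]
  · intro x _ h ih
    rw [delivered_succ_of_ne (fun _ => h _)]
    exact ih
  · intro x _ a s' he hl hs ih
    clear hs
    generalize E.state x i = s at *
    cases hl
    case deliver ms _ hh =>
      rw [delivered_succ_of_deliver he]
      rintro (hm | hm)
      · exact (ih hm).trans (hh.tsa_le r)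
      · exact hh.le_tsa hm hc
    all_goals
      rw [delivered_succ_of_ne (by simp [he])]
      exact ih

theorem tsa_le_of_subset (hE : E.IsRun t v₀) {i j : Fin n} {x y : ℕ}
    (h : E.delivered i x ⊆ E.delivered j y) : (E.state x i).tsa ≤ (E.state y j).tsa := by
  intro r
  rcases hE.registers_eq i x r with ⟨h1, -⟩ | ⟨msg, hm, d, k, hc, h1⟩
  · rw [h1]
    exact Timestamp.initial_le _
  · rw [h1]
    exact hE.le_tsa (h hm) hc

theorem isChain_tsaValues (hE : E.IsRun t v₀) : IsChain (· ≤ ·) E.tsaValues := by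
  rintro _ ⟨i, x, -, -, rfl⟩ _ ⟨j, y, -, -, rfl⟩ -
  exact (hE.scd.deliveredBefore_total i j (x + 1) (y + 1)).imp hE.tsa_le_of_subset
    hE.tsa_le_of_subset

end IsRun

/-! ### Progress of an operation and the messages it has sent -/

/-- Process `i` does not return from an operation strictly between `τ` and `x`. -/
def Silent (E : Execution n m V) (i : Fin n) (τ x : ℕ) : Prop :=
  ∀ ρ res, τ < ρ → ρ < x → E.event ρ ≠ some (i, .respond res)

theorem Silent.mono {i : Fin n} {τ x y : ℕ} (h : E.Silent i τ x) (hxy : y ≤ x) :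
    E.Silent i τ y := fun ρ res h1 h2 => h ρ res h1 (by omega)

/-- Process `i` broadcasts a message `SYNC(i)` strictly between `τ` and `x`. -/
def SyncSent (E : Execution n m V) (i : Fin n) (τ x : ℕ) : Prop :=
  ∃ ρ tag, τ < ρ ∧ ρ < x ∧ E.event ρ = some (i, .broadcast ⟨.sync i, tag⟩)

/-- Process `i` broadcasts a message `WRITE(r, v, -)` strictly between `τ` and `x`. -/
def WriteSent (E : Execution n m V) (i : Fin n) (τ x : ℕ) (r : Fin m) (v : V) : Prop :=
  ∃ ρ d tag, τ < ρ ∧ ρ < x ∧ E.event ρ = some (i, .broadcast ⟨.write r v d i, tag⟩)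

theorem SyncSent.mono {i : Fin n} {τ x y : ℕ} (h : E.SyncSent i τ x) (hxy : x ≤ y) :
    E.SyncSent i τ y := by
  obtain ⟨ρ, tag, h1, h2, h3⟩ := h
  exact ⟨ρ, tag, h1, by omega, h3⟩

theorem WriteSent.mono {i : Fin n} {τ x y : ℕ} {r : Fin m} {v : V} (h : E.WriteSent i τ x r v)
    (hxy : x ≤ y) : E.WriteSent i τ y r v := by
  obtain ⟨ρ, d, tag, h1, h2, h3⟩ := h
  exact ⟨ρ, d, tag, h1, by omega, h3⟩

/-- No message `WRITE(-, -, -)` is broadcast by process `i` strictly between `τ` and `x`. -/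
def NoWriteSent (E : Execution n m V) (i : Fin n) (τ x : ℕ) : Prop :=
  ∀ ρ r v d j tag, τ < ρ → ρ < x → E.event ρ ≠ some (i, .broadcast ⟨.write r v d j, tag⟩)

theorem NoWriteSent.succ {i : Fin n} {τ x : ℕ} (h : E.NoWriteSent i τ x)
    (hx : ∀ r v d j tag, E.event x ≠ some (i, .broadcast ⟨.write r v d j, tag⟩)) :
    E.NoWriteSent i τ (x + 1) := by
  intro ρ r v d j tag h1 h2
  rcases Nat.lt_succ_iff_lt_or_eq.1 h2 with h2 | rfl
  · exact h ρ r v d j tag h1 h2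
  · exact hx r v d j tag

/-- The state of progress of the operation `op` invoked by process `i` at instant `τ`, according to
the control point at instant `x`. -/
def Engaged (E : Execution n m V) (i : Fin n) (τ x : ℕ) (op : Op m V) (c : Control m V) : Prop :=
  c = .crashed ∨ (c.op = some op ∧
    match c with
    | .line2r | .line3 | .line4 => E.SyncSent i τ x
    | .line5 _ _ | .line6 _ _ => E.NoWriteSent i τ x
    | .line6r _ _ | .line7 _ _ | .line8 _ _ | .line9 _ _ => E.SyncSent i τ x ∧ E.NoWriteSent i τ x
    | .line9r r v | .line10 r v => E.WriteSent i τ x r v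
    | _ => True)

namespace IsRun

/-- The facts recorded are those needed later: a `SYNC` sent within the operation makes it recent,
the absence of a `WRITE` up to `line9` makes the timestamp of a write unique, and a `WRITE` sent by
`line10` makes a completed write effective. -/
theorem engaged (hE : E.IsRun t v₀) {i : Fin n} {τ : ℕ} {op : Op m V} (h : E.Invokes i τ op)
    {x : ℕ} (hx : τ < x) (hs : E.Silent i τ x) : E.Engaged i τ x op (E.state x i).control := by
  revert hs
  refine hE.induction i (fun x s => E.Silent i τ x → E.Engaged i τ x op s.control) (τ + 1) ?_ ?_ ?_
    x hx
  · intro _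
    have hl := hE.localStep h
    generalize E.state (τ + 1) i = s' at *
    generalize E.state τ i = s at *
    cases hl
    · exact Or.inr ⟨rfl, trivial⟩
    · exact Or.inr ⟨rfl, fun ρ _ _ _ _ _ h1 h2 => by omega⟩
  · intro x _ hne ih hs
    have h2 := fun h : E.NoWriteSent i τ x => h.succ fun _ _ _ _ _ => hne _
    specialize ih (hs.mono (by omega))
    generalize (E.state x i).control = c at *
    rcases ih with ih | ⟨h1, ih⟩
    · exact Or.inl ih
    · refine Or.inr ⟨h1, ?_⟩
      cases c
      case line2r | line3 | line4 => exact SyncSent.mono ih (by omega)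
      case line5 | line6 => exact h2 ih
      case line6r | line7 | line8 | line9 => exact ⟨ih.1.mono (by omega), h2 ih.2⟩
      case line9r | line10 => exact WriteSent.mono ih (by omega)
      all_goals trivial
  · intro x hx a s' he hl hs' ih hs
    clear hs'
    have h3 : E.SyncSent i τ x → E.SyncSent i τ (x + 1) := fun h => h.mono (by omega)
    have h4 : ∀ r v, E.WriteSent i τ x r v → E.WriteSent i τ (x + 1) r v :=
      fun r v h => h.mono (by omega)
    specialize ih (hs.mono (by omega))
    have h5 : ∀ res, a ≠ .respond res := by
      rintro res rfl
      exact hs x res hx (by omega) he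
    have h6 := fun (h : E.NoWriteSent i τ x)
      (hx : ∀ r v d j tag, E.event x ≠ some (i, .broadcast ⟨.write r v d j, tag⟩)) => h.succ hx
    have h7 : ∀ tag, E.event x = some (i, .broadcast ⟨.sync i, tag⟩) → E.SyncSent i τ (x + 1) :=
      fun tag h => ⟨x, tag, hx, by omega, h⟩
    have h8 : ∀ r v d tag, E.event x = some (i, .broadcast ⟨.write r v d i, tag⟩) →
      E.WriteSent i τ (x + 1) r v := fun r v d tag h => ⟨x, d, tag, hx, by omega, h⟩
    clear hx hs
    generalize E.state x i = s at *
    obtain ⟨c, dn, rg, ta, sn⟩ := s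
    cases hl
    case deliver ms hc hh =>
      have hcc := hh.control_eq
      simp only at hcc ih hc
      rw [hcc]
      clear hcc hh
      simp only [he] at h6
      unfold Engaged at *
      cases c <;> simp_all [Control.op]
    case crash => exact Or.inl rfl
    all_goals
      simp only at *
      subst_vars
      unfold Engaged at *
      simp_all [Control.op]

theorem exists_invokes (hE : E.IsRun t v₀) {i : Fin n} {x : ℕ} {op : Op m V}
    (h : (E.state x i).control.op = some op) :
    ∃ τ < x, E.Invokes i τ op ∧ E.Silent i τ x := by
  revert h
  refine hE.induction i (fun x s => s.control.op = some op →
    ∃ τ < x, E.Invokes i τ op ∧ E.Silent i τ x) 0 ?_ ?_ ?_ x (Nat.zero_le x)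
  · rw [hE.initial]
    simp [ProcState.initial, Control.op]
  · intro x _ hne ih h
    obtain ⟨τ, h1, h2, h3⟩ := ih h
    refine ⟨τ, by omega, h2, fun ρ res h4 h5 => ?_⟩
    rcases Nat.lt_succ_iff_lt_or_eq.1 h5 with h5 | rfl
    · exact h3 ρ res h4 h5
    · exact hne _
  · intro x _ a s' he hl hs ih h
    clear hs
    have hold : (E.state x i).control.op = some op → (∀ res, a ≠ .respond res) →
        ∃ τ < x + 1, E.Invokes i τ op ∧ E.Silent i τ (x + 1) := by
      intro h hne
      obtain ⟨τ, h1, h2, h3⟩ := ih h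
      refine ⟨τ, by omega, h2, fun ρ res h4 h5 => ?_⟩
      rcases Nat.lt_succ_iff_lt_or_eq.1 h5 with h5 | rfl
      · exact h3 ρ res h4 h5
      · rw [he]
        simpa using hne res
    have hnew : E.event x = some (i, .invoke op) →
        ∃ τ < x + 1, E.Invokes i τ op ∧ E.Silent i τ (x + 1) :=
      fun h => ⟨x, by omega, h, fun ρ _ _ _ => by omega⟩
    clear ih
    generalize E.state x i = s at *
    cases hl
    case deliver ms hc hh => 
      rw [hh.control_eq] at h
      exact hold h (by simp)
    case crash | line4 | line10 => simp [Control.op] at h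
    case invokeSnapshot | invokeWrite =>
      simp only [Control.op, Option.some.injEq] at h
      subst h
      exact hnew he
    all_goals
      refine hold ?_ (by simp)
      simp_all [Control.op]

end IsRun

end Execution

/-! ### Wait-freedom -/

/-- The control points at which the process has not yet returned from `scd_broadcast`. -/
def Control.AwaitsReturn {m : ℕ} {V : Type*} : Control m V → Prop
  | .line2r | .line6r _ _ | .line9r _ _ => True
  | _ => False

/-- The control points at which the process waits for `done`. -/
def Control.AwaitsDone {m : ℕ} {V : Type*} : Control m V → Prop
  | .line3 | .line7 _ _ | .line10 _ _ => True
  | _ => False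

theorem Control.rank_le {m : ℕ} {V : Type*} (c : Control m V) : c.rank ≤ 8 := by
  cases c <;> simp [Control.rank]

theorem LocalStep.exists_own {n m : ℕ} {V : Type*} (i : Fin n) {s : ProcState n m V} {op : Op m V}
    (hop : s.control.op = some op) (hr : ¬ s.control.AwaitsReturn)
    (hd : s.control.AwaitsDone → s.done = true) :
    ∃ a s', Act.IsOwn a ∧ LocalStep i s a s' := by
  have own : ∀ {a s'}, LocalStep i s a s' → Act.IsOwn a → ∃ a s', Act.IsOwn a ∧ LocalStep i s a s' :=
    fun h h' => ⟨_, _, h', h⟩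
  rcases hc : s.control with _ | _ | _ | _ | _ | _ | ⟨r, v⟩ | ⟨r, v⟩ | ⟨r, v⟩ | ⟨r, v⟩ | ⟨r, v⟩ |
    ⟨r, v⟩ | ⟨r, v⟩ | ⟨r, v⟩ | _ <;>
    simp only [hc, Control.op, Control.AwaitsReturn, Control.AwaitsDone, not_true, reduceCtorEq,
      true_imp_iff] at hop hr hd
  · exact own (LocalStep.line1 s hc) trivial
  · exact own (LocalStep.line2 s hc) trivial
  · exact own (LocalStep.line3 s hc hd) trivial
  · exact own (LocalStep.line4 s hc) trivial
  · exact own (LocalStep.line5 s r v hc) trivial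
  · exact own (LocalStep.line6 s r v hc) trivial
  · exact own (LocalStep.line7 s r v hc hd) trivial
  · exact own (LocalStep.line8 s r v hc) trivial
  · exact own (LocalStep.line9 s r v hc) trivial
  · exact own (LocalStep.line10 s r v hc hd) trivial

theorem LocalStep.rank_lt {n m : ℕ} {V : Type*} {i : Fin n} {s s' : ProcState n m V}
    {a : Act n m V} (h : LocalStep i s a s') (ha : a.IsOwn ∨ a = .broadcastReturn)
    (hres : ∀ res, a ≠ .respond res) : s.control.rank < s'.control.rank := by
  cases h <;> simp_all [Control.rank, Act.IsOwn]

theorem LocalStep.control_eq {n m : ℕ} {V : Type*} {i : Fin n} {s s' : ProcState n m V}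
    {a : Act n m V} (h : LocalStep i s a s') (ha : ¬ a.IsOwn) (ha' : a ≠ .broadcastReturn)
    (hop : s.control ≠ .idle) (hcr : a ≠ .crash) : s'.control = s.control := by
  cases h
  case deliver h => exact h.control_eq
  all_goals simp_all [Act.IsOwn]

namespace Execution

variable {n m t : ℕ} {V : Type*} {v₀ : Fin m → V} {E : Execution n m V}

namespace IsRun

theorem control_ne_crashed (hE : E.IsRun t v₀) {i : Fin n} (hi : i ∈ E.correct) (x : ℕ) :
    (E.state x i).control ≠ .crashed := by
  refine hE.induction i (fun _ s => s.control ≠ .crashed) 0 ?_ ?_ ?_ x (Nat.zero_le x)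
  · rw [hE.initial]
    simp [ProcState.initial]
  · exact fun _ _ _ h => h
  · intro x _ a s' he hl hs ih
    cases hl
    case deliver h => rwa [h.control_eq]
    case crash => exact absurd ⟨x, he⟩ hi
    all_goals simp

/-- Termination-1 promises a return after this broadcast; since none has occurred before `x`, it
must occur at `x` or later. -/
theorem exists_last_broadcast (hE : E.IsRun t v₀) {i : Fin n} {x : ℕ}
    (h : (E.state x i).control.AwaitsReturn) :
    ∃ ρ < x, ∃ msg, E.event ρ = some (i, .broadcast msg) ∧
      ∀ σ, ρ < σ → σ < x → E.event σ ≠ some (i, .broadcastReturn) := by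
  revert h
  refine hE.induction i (fun x s => s.control.AwaitsReturn →
    ∃ ρ < x, ∃ msg, E.event ρ = some (i, .broadcast msg) ∧
      ∀ σ, ρ < σ → σ < x → E.event σ ≠ some (i, .broadcastReturn)) 0 ?_ ?_ ?_ x (Nat.zero_le x)
  · rw [hE.initial]
    simp [ProcState.initial, Control.AwaitsReturn]
  · intro x _ hne ih h
    obtain ⟨ρ, h1, msg, h2, h3⟩ := ih h
    refine ⟨ρ, by omega, msg, h2, fun σ h4 h5 => ?_⟩
    rcases Nat.lt_succ_iff_lt_or_eq.1 h5 with h5 | rfl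
    · exact h3 σ h4 h5
    · exact hne _
  · intro x _ a s' he hl hs ih h
    clear hs
    have hnew : ∀ msg, E.event x = some (i, .broadcast msg) → ∃ ρ < x + 1, ∃ msg,
        E.event ρ = some (i, .broadcast msg) ∧
          ∀ σ, ρ < σ → σ < x + 1 → E.event σ ≠ some (i, .broadcastReturn) :=
      fun msg h => ⟨x, by omega, msg, h, fun _ _ _ => by omega⟩
    cases hl
    case deliver ms hc hh =>
      rw [hh.control_eq] at h
      obtain ⟨ρ, h1, msg, h2, h3⟩ := ih h
      refine ⟨ρ, by omega, msg, h2, fun σ h4 h5 => ?_⟩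
      rcases Nat.lt_succ_iff_lt_or_eq.1 h5 with h5 | rfl
      · exact h3 σ h4 h5
      · simp [he]
    case line2 | line6 | line9 => exact hnew _ he
    all_goals simp [Control.AwaitsReturn] at h

/-- A non-faulty process that is engaged in an operation eventually executes a statement. -/
theorem exists_own_event (hE : E.IsRun t v₀) {i : Fin n} (hi : i ∈ E.correct) {x : ℕ} {op : Op m V}
    (hop : (E.state x i).control.op = some op) :
    ∃ y ≥ x, ∃ a, E.event y = some (i, a) ∧ (a.IsOwn ∨ a = .broadcastReturn) := by
  by_contra! hN
  -- With no own statement and no return from a broadcast, only deliveries remain possible here, and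
  -- they leave the control point unchanged.
  have hconst : ∀ y ≥ x, (E.state y i).control = (E.state x i).control := by
    refine hE.induction i (fun _ s => s.control = (E.state x i).control) x rfl
      (fun _ _ _ h => h) ?_
    intro y hy a s' he hl hs ih
    rw [← ih]
    obtain ⟨h1, h2⟩ := hN y hy a he
    refine hl.control_eq h1 h2 ?_ ?_
    · intro h
      rw [← ih, h] at hop
      simp [Control.op] at hop
    · rintro rfl
      exact hi ⟨y, he⟩
  by_cases hr : (E.state x i).control.AwaitsReturn
  · obtain ⟨ρ, h1, msg, h2, h3⟩ := hE.exists_last_broadcast hr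
    obtain ⟨⟨σ, h4, h5⟩, -⟩ := hE.scd.properties.termination1 i hi ρ msg (comm_broadcastsAt.2 h2)
    rw [comm_broadcastReturn] at h5
    rcases lt_or_ge σ x with h6 | h6
    · exact h3 σ h4 h6 h5
    · exact (hN σ h6 _ h5).2 rfl
  · have hstuck : ∀ y ≥ x, ¬ ((E.state y i).control.AwaitsDone → (E.state y i).done = true) := by
      intro y hy hd
      obtain ⟨σ, h1, a, h2, h3⟩ := hE.progress i hi y
        (LocalStep.exists_own i (by rw [hconst y hy, hop]) (by rwa [hconst y hy]) hd)
      exact (hN σ (by omega) a h3).1 h2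
    have hx := hstuck x le_rfl
    rw [Classical.not_imp] at hx
    have hp := hE.pendingInv i x
    -- The process waits with `done` false, so a message is pending. Termination-1 delivers it at
    -- some `y ≥ x`, which sets `done` while control has not moved and contradicts `hstuck`.
    have hU : E.pending i x ≠ ∅ := by
      intro h
      generalize (E.state x i).control = c at *
      cases c <;> simp_all [Control.AwaitsDone, Control.PendingInv]
    obtain ⟨msg, ⟨ρ, h1, h2⟩, h3⟩ := Set.nonempty_iff_ne_empty.2 hU
    obtain ⟨-, y, ms, h4, h5⟩ :=
      hE.scd.properties.termination1 i hi ρ msg (comm_broadcastsAt.2 h2)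
    have hy : x ≤ y := by
      by_contra hlt
      exact h3 ⟨y, by omega, ms, h4, h5⟩
    rw [comm_deliversAt] at h4
    refine hstuck (y + 1) (by omega) fun _ => ?_
    have hl := hE.localStep h4
    generalize E.state (y + 1) i = s' at hl
    cases hl with
    | deliver _ _ _ hh => exact hh.done_iff.2 (Or.inr ⟨msg, h5, (hE.broadcast_spec h2).1⟩)

theorem exists_completes {i : Fin n} {τ σ : ℕ} {op : Op m V} {res : Resp m V}
    (h : E.Invokes i τ op) (hσ : τ < σ) (hr : E.event σ = some (i, .respond res)) :
    ∃ σ' ≤ σ, ∃ res', E.Completes i τ op σ' res' := by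
  classical
  have hex : ∃ y, τ < y ∧ ∃ res, E.event y = some (i, .respond res) := ⟨σ, hσ, res, hr⟩
  obtain ⟨h1, res', h2⟩ := Nat.find_spec hex
  refine ⟨Nat.find hex, Nat.find_min' hex ⟨hσ, res, hr⟩, res', h, h1, h2, fun ρ res'' h3 h4 h5 => ?_⟩
  exact Nat.find_min hex h4 ⟨h3, res'', h5⟩

theorem waitFree (hE : E.IsRun t v₀) : E.WaitFree := by
  intro i hi τ op hinv
  by_contra hcon
  have hno : ∀ σ res, τ < σ → E.event σ ≠ some (i, .respond res) := by
    intro σ res hσ hr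
    obtain ⟨σ', -, res', h⟩ := exists_completes hinv hσ hr
    exact hcon ⟨σ', res', h⟩
  have hop : ∀ x, τ < x → (E.state x i).control.op = some op := by
    intro x hx
    rcases hE.engaged hinv hx (fun ρ res h _ => hno ρ res h) with h | h
    · exact absurd h (hE.control_ne_crashed hi x)
    · exact h.1
  have hmono : ∀ x, τ < x → (E.state x i).control.rank ≤ (E.state (x + 1) i).control.rank := by
    intro x hx
    rcases hE.step_cases i x with ⟨h, -⟩ | ⟨a, h1, h2⟩
    · rw [h]
    · by_cases ha : a.IsOwn ∨ a = .broadcastReturn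
      · refine (h2.rank_lt ha ?_).le
        rintro res rfl
        exact hno x res hx h1
      · rw [not_or] at ha
        rw [h2.control_eq ha.1 ha.2]
        · intro h
          have := hop x hx
          rw [h] at this
          simp [Control.op] at this
        · rintro rfl
          exact hi ⟨x, h1⟩
  have hunb : ∀ N, ∃ x, τ < x ∧ N ≤ (E.state x i).control.rank := by
    intro N
    induction N with
    | zero => exact ⟨τ + 1, by omega, Nat.zero_le _⟩
    | succ N ih =>
      obtain ⟨x, hx, hN⟩ := ih
      obtain ⟨y, hy, a, h1, h2⟩ := hE.exists_own_event hi (hop x hx)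
      refine ⟨y + 1, by omega, ?_⟩
      have h3 : (E.state x i).control.rank ≤ (E.state y i).control.rank := by
        clear h1
        induction y, hy using Nat.le_induction with
        | base => exact le_rfl
        | succ y hy ih => exact ih.trans (hmono y (by omega))
      have h4 := (hE.localStep h1).rank_lt h2 (by
        rintro res rfl
        exact hno y res (by omega) h1)
      omega
  -- No control point has rank above 8.
  obtain ⟨x, -, hx⟩ := hunb 9
  have := (E.state x i).control.rank_le
  omega

end IsRun

end Execution

/-! ### Linearization -/

/-- A set of numbers that is well ordered in type at most `ω` by the values of `f` can be arranged in
a sequence. -/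
theorem exists_position {α : Type*} [LinearOrder α] {L : Set ℕ} {f : ℕ → α}
    (hfin : ∀ x ∈ L, {y | y ∈ L ∧ f y < f x}.Finite) :
    ∃ pos : ℕ → ℕ, ∀ x ∈ L, ∀ y ∈ L, pos x < pos y ↔ f x < f y := by
  -- The position is the number of predecessors; finiteness matters because `ncard` is 0 on infinite
  -- sets.
  refine ⟨fun x => {y | y ∈ L ∧ f y < f x}.ncard, ?_⟩
  have hlt : ∀ x ∈ L, ∀ y ∈ L, f x < f y →
      {z | z ∈ L ∧ f z < f x}.ncard < {z | z ∈ L ∧ f z < f y}.ncard := by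
    intro x hx y hy h
    refine Set.ncard_lt_ncard ⟨fun z hz => ⟨hz.1, hz.2.trans h⟩, fun hs => ?_⟩ (hfin y hy)
    exact lt_irrefl _ (hs ⟨hx, h⟩ : x ∈ L ∧ f x < f x).2
  intro x hx y hy
  refine ⟨fun h => ?_, hlt x hx y hy⟩
  rcases lt_trichotomy (f x) (f y) with h' | h' | h'
  · exact h'
  · simp only [h', lt_irrefl] at h
  · exact absurd (hlt y hy x hx h') h.not_gt

namespace Execution

variable {n m t : ℕ} {V : Type*} {v₀ : Fin m → V} {E : Execution n m V}

/-- The write operation `τ` of `v` in register `r` by process `i` broadcasts its message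
`WRITE(r, v, ts)`. -/
def Wrote (E : Execution n m V) (τ : ℕ) (i : Fin n) (r : Fin m) (v : V) (ts : Timestamp n) : Prop :=
  E.Invokes i τ (.write r v) ∧ ∃ ρ d tag, τ < ρ ∧ E.Silent i τ ρ ∧
    E.event ρ = some (i, .broadcast ⟨.write r v d i, tag⟩) ∧
    ts = toLex (d, (i : WithBot (Fin n)))

/-- The least size of a set of delivered messages that makes `tsa[r]` reach `ts`. -/
noncomputable def writeRank (E : Execution n m V) (r : Fin m) (ts : Timestamp n) : ℕ :=
  sInf {k | ∃ j x, ts ≤ (E.state x j).tsa r ∧ (E.delivered j x).ncard = k}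

/-- `IsKey E τ κ`: the operation `τ` takes part in the linearization, where the operations are
sorted by `κ`. -/
inductive IsKey (E : Execution n m V) (τ : ℕ) : ℕ ×ₗ ℕ ×ₗ Timestamp n ×ₗ ℕ → Prop where
  -- The bound by some `tsa r` keeps `writeRank` from being the infimum of an empty set, which would
  -- be 0. The entries 0 and 1 put writes before snapshots at equal size, and the final `τ` makes
  -- keys distinct.
  | write (i : Fin n) (r : Fin m) (v : V) (ts : Timestamp n) (j : Fin n) (x : ℕ) :
      E.Wrote τ i r v ts → ts ≤ (E.state x j).tsa r →
      IsKey E τ (toLex (E.writeRank r ts, toLex (0, toLex (ts, τ))))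
  | snapshot (i : Fin n) (σ : ℕ) (res : Resp m V) : E.Completes i τ .snapshot σ res →
      IsKey E τ (toLex ((E.delivered i σ).ncard, toLex (1, toLex (toLex (0, ⊥), τ))))

theorem Invokes.unique {i j : Fin n} {τ : ℕ} {op op' : Op m V} (h : E.Invokes i τ op)
    (h' : E.Invokes j τ op') : i = j ∧ op = op' := by
  unfold Invokes at h h'
  rw [h] at h'
  cases h'
  exact ⟨rfl, rfl⟩

theorem Completes.unique {i j : Fin n} {τ σ σ' : ℕ} {op op' : Op m V} {res res' : Resp m V}
    (h : E.Completes i τ op σ res) (h' : E.Completes j τ op' σ' res') : i = j ∧ σ = σ' := by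
  obtain ⟨rfl, rfl⟩ := h.1.unique h'.1
  refine ⟨rfl, ?_⟩
  rcases lt_trichotomy σ σ' with hl | hl | hl
  · exact absurd h.2.2.1 (h'.2.2.2 σ res h.2.1 hl)
  · exact hl
  · exact absurd h'.2.2.1 (h.2.2.2 σ' res' h'.2.1 hl)

theorem Completes.silent {i : Fin n} {τ σ : ℕ} {op : Op m V} {res : Resp m V}
    (h : E.Completes i τ op σ res) : E.Silent i τ σ := h.2.2.2

theorem writeRank_le {r : Fin m} {ts : Timestamp n} {j : Fin n} {x : ℕ}
    (h : ts ≤ (E.state x j).tsa r) : E.writeRank r ts ≤ (E.delivered j x).ncard :=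
  Nat.sInf_le ⟨j, x, h, rfl⟩

theorem exists_writeRank_eq {r : Fin m} {ts : Timestamp n} {j : Fin n} {x : ℕ}
    (h : ts ≤ (E.state x j).tsa r) :
    ∃ j x, ts ≤ (E.state x j).tsa r ∧ (E.delivered j x).ncard = E.writeRank r ts :=
  Nat.sInf_mem (s := {k | ∃ j x, ts ≤ (E.state x j).tsa r ∧ (E.delivered j x).ncard = k})
    ⟨_, j, x, h, rfl⟩

theorem writeRank_mono {r : Fin m} {ts ts' : Timestamp n} (hle : ts ≤ ts') {j : Fin n} {x : ℕ}
    (h : ts' ≤ (E.state x j).tsa r) : E.writeRank r ts ≤ E.writeRank r ts' := by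
  obtain ⟨k, y, h1, h2⟩ := exists_writeRank_eq h
  rw [← h2]
  exact writeRank_le (hle.trans h1)

namespace IsRun

theorem of_broadcast_write (hE : E.IsRun t v₀) {i j : Fin n} {ρ : ℕ} {r : Fin m} {v : V} {d tag : ℕ}
    (h : E.event ρ = some (i, .broadcast ⟨.write r v d j, tag⟩)) :
    j = i ∧ (E.state ρ i).control = .line9 r v ∧ d = (ofLex ((E.state ρ i).tsa r)).1 + 1 := by
  have hl := hE.localStep h
  clear h
  generalize E.state (ρ + 1) i = s' at hl
  cases hl
  case line9 h => exact ⟨rfl, h, rfl⟩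

theorem of_respond (hE : E.IsRun t v₀) {i : Fin n} {σ : ℕ} {res : Resp m V}
    (h : E.event σ = some (i, .respond res)) :
    ((E.state σ i).control = .line4 ∧ res = .view (E.state σ i).reg) ∨
      ∃ r v, (E.state σ i).control = .line10 r v ∧ (E.state σ i).done = true ∧ res = .ack := by
  have hl := hE.localStep h
  clear h
  generalize E.state (σ + 1) i = s' at hl
  cases hl
  case line4 h => exact Or.inl ⟨h, rfl⟩
  case line10 r v h hd => exact Or.inr ⟨r, v, h, hd, rfl⟩

theorem control_of_invokes (hE : E.IsRun t v₀) {i : Fin n} {τ : ℕ} {op : Op m V}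
    (h : E.Invokes i τ op) : (E.state τ i).control = .idle := by
  have hl := hE.localStep h
  generalize E.state (τ + 1) i = s' at hl
  cases hl <;> assumption

theorem mem_delivered_of_pending_eq_empty {i : Fin n} {ρ x : ℕ} {msg : Msg n m V}
    (h : E.pending i x = ∅) (hb : E.event ρ = some (i, .broadcast msg)) (hρ : ρ < x) :
    msg ∈ E.delivered i x := by
  by_contra hd
  exact (h ▸ (⟨⟨ρ, hρ, hb⟩, hd⟩ : msg ∈ E.pending i x) : msg ∈ (∅ : Set (Msg n m V)))

/-- Nothing is pending at `line4`, so the `SYNC` of this very snapshot has been delivered. -/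
theorem completes_snapshot (hE : E.IsRun t v₀) {i : Fin n} {τ σ : ℕ} {res : Resp m V}
    (h : E.Completes i τ .snapshot σ res) :
    res = .view (E.state σ i).reg ∧
      ∃ ρ msg, τ < ρ ∧ E.event ρ = some (i, .broadcast msg) ∧ msg ∈ E.delivered i σ := by
  have he := hE.engaged h.1 h.2.1 h.silent
  have hp := hE.pendingInv i σ
  rcases hE.of_respond h.2.2.1 with ⟨h1, h2⟩ | ⟨r, v, h1, -, -⟩
  · simp only [h1, Engaged, reduceCtorEq, false_or] at he
    obtain ⟨-, ρ, tag, h3, h4, h5⟩ := he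
    simp only [h1, Control.PendingInv] at hp
    exact ⟨h2, ρ, _, h3, h5, mem_delivered_of_pending_eq_empty hp h5 h4⟩
  · simp [h1, Engaged, Control.op] at he

theorem completes_write (hE : E.IsRun t v₀) {i : Fin n} {τ σ : ℕ} {res : Resp m V} {r : Fin m}
    {v : V} (h : E.Completes i τ (.write r v) σ res) :
    res = .ack ∧ ∃ ts, E.Wrote τ i r v ts ∧ ts ≤ (E.state σ i).tsa r := by
  have he := hE.engaged h.1 h.2.1 h.silent
  have hp := hE.pendingInv i σ
  rcases hE.of_respond h.2.2.1 with ⟨h1, -⟩ | ⟨r', v', h1, h2, h3⟩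
  · simp [h1, Engaged, Control.op] at he
  · simp only [h1, Engaged, reduceCtorEq, false_or, Control.op, Option.some.injEq,
      Op.write.injEq] at he
    obtain ⟨⟨rfl, rfl⟩, ρ, d, tag, h4, h5, h6⟩ := he
    simp only [h1, Control.PendingInv, h2, true_iff] at hp
    exact ⟨h3, _, ⟨h.1, ρ, d, tag, h4, h.silent.mono h5.le, h6, rfl⟩,
      hE.le_tsa (mem_delivered_of_pending_eq_empty hp.2 h6 h5) rfl⟩

theorem wrote_unique (hE : E.IsRun t v₀) {τ : ℕ} {i j : Fin n} {r r' : Fin m} {v v' : V}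
    {ts ts' : Timestamp n} (h : E.Wrote τ i r v ts) (h' : E.Wrote τ j r' v' ts') :
    r = r' ∧ v = v' ∧ ts = ts' := by
  obtain ⟨h1, ρ, d, tag, h2, h3, h4, rfl⟩ := h
  obtain ⟨h1', ρ', d', tag', h2', h3', h4', rfl⟩ := h'
  obtain ⟨rfl, h5⟩ := h1.unique h1'
  cases h5
  -- The later of two `WRITE` broadcasts would start from `line9`, where `Engaged` rules out an
  -- earlier one in the same operation.
  have key : ∀ {ρ ρ' d d' tag tag'}, τ < ρ → E.Silent i τ ρ' →
      E.event ρ = some (i, .broadcast ⟨.write r v d i, tag⟩) →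
      E.event ρ' = some (i, .broadcast ⟨.write r v d' i, tag'⟩) → ¬ ρ < ρ' := by
    intro ρ ρ' d d' tag tag' hρ hs hb hb' hlt
    have he := hE.engaged h1 (hρ.trans hlt) hs
    rw [(hE.of_broadcast_write hb').2.1] at he
    simp only [Engaged, reduceCtorEq, false_or] at he
    exact he.2.2 ρ _ _ _ _ _ hρ hlt hb
  obtain rfl : ρ = ρ' := le_antisymm (not_lt.1 (key h2' h3 h4' h4)) (not_lt.1 (key h2 h3' h4 h4'))
  rw [h4] at h4'
  cases h4'
  exact ⟨rfl, rfl, rfl⟩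

/-- When an operation broadcasts `WRITE(r, v, ts)`, the process has delivered a message broadcast
during the operation, and the timestamp of `r` is smaller than `ts`. -/
theorem wrote_spec (hE : E.IsRun t v₀) {τ : ℕ} {i : Fin n} {r : Fin m} {v : V} {ts : Timestamp n}
    (h : E.Wrote τ i r v ts) :
    ∃ x, (E.state x i).tsa r < ts ∧
      ∃ ρ msg, τ < ρ ∧ E.event ρ = some (i, .broadcast msg) ∧ msg ∈ E.delivered i x := by
  obtain ⟨h1, x, d, tag, h2, h3, h4, rfl⟩ := h
  obtain ⟨-, h5, rfl⟩ := hE.of_broadcast_write h4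
  refine ⟨x, Timestamp.lt_succ_date _ _, ?_⟩
  have he := hE.engaged h1 h2 h3
  have hp := hE.pendingInv i x
  simp only [h5, Engaged, reduceCtorEq, false_or] at he
  simp only [h5, Control.PendingInv] at hp
  obtain ⟨-, ⟨ρ, tag, h6, h7, h8⟩, -⟩ := he
  exact ⟨ρ, _, h6, h8, mem_delivered_of_pending_eq_empty hp.1 h8 h7⟩

theorem initial_lt_of_wrote (hE : E.IsRun t v₀) {τ : ℕ} {i : Fin n} {r : Fin m} {v : V}
    {ts : Timestamp n} (h : E.Wrote τ i r v ts) : toLex (0, ⊥) < ts := by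
  obtain ⟨x, hx, -⟩ := hE.wrote_spec h
  exact (Timestamp.initial_le _).trans_lt hx

theorem wrote_of_writesOp {τ : ℕ} {i : Fin n} {r r' : Fin m} {v w : V} {ts : Timestamp n}
    (h : E.Wrote τ i r v ts) (h' : E.WritesOp τ r' w) : r' = r ∧ w = v := by
  obtain ⟨j, h'⟩ := h'
  cases (h'.unique h.1).2
  exact ⟨rfl, rfl⟩

theorem exists_wrote_of_mem_delivered (hE : E.IsRun t v₀) {i j : Fin n} {x d : ℕ} {r : Fin m} {v : V}
    {msg : Msg n m V} (hm : msg ∈ E.delivered i x) (hc : msg.content = .write r v d j) :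
    ∃ τ, E.Wrote τ j r v (toLex (d, (j : WithBot (Fin n)))) := by
  obtain ⟨ρ, -, hb⟩ := hE.exists_broadcast_of_mem_delivered hm
  obtain ⟨c, tag⟩ := msg
  simp only at hc
  subst hc
  simp only [Msg.proc] at hb
  obtain ⟨-, h1, -⟩ := hE.of_broadcast_write hb
  obtain ⟨τ, h2, h3, h4⟩ := hE.exists_invokes (x := ρ) (i := j) (op := .write r v) (by rw [h1]; rfl)
  exact ⟨τ, h3, ρ, d, tag, h2, h4, hb, rfl⟩

theorem ncard_delivered_lt {i j : Fin n} {x y : ℕ}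
    (h : E.delivered i x ⊂ E.delivered j y) :
    (E.delivered i x).ncard < (E.delivered j y).ncard :=
  Set.ncard_lt_ncard h (E.comm.deliveredBefore_finite j y)

theorem isKey_unique (hE : E.IsRun t v₀) {τ : ℕ} {κ κ' : ℕ ×ₗ ℕ ×ₗ Timestamp n ×ₗ ℕ}
    (h : E.IsKey τ κ) (h' : E.IsKey τ κ') : κ = κ' := by
  rcases h with ⟨i, r, v, ts, j, x, h1, -⟩ | ⟨i, σ, res, h1⟩ <;>
    rcases h' with ⟨i', r', v', ts', j', x', h1', -⟩ | ⟨i', σ', res', h1'⟩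
  · obtain ⟨rfl, -, rfl⟩ := hE.wrote_unique h1 h1'
    rfl
  · cases (h1.1.unique h1'.1).2
  · cases (h1.1.unique h1'.1).2
  · obtain ⟨rfl, rfl⟩ := h1.unique h1'
    rfl

/-- A completed write has delivered its own `WRITE`, so its process already has `tsa[r]` at least
`ts` on return. -/
theorem exists_isKey_of_completes (hE : E.IsRun t v₀) {i : Fin n} {τ σ : ℕ} {op : Op m V}
    {res : Resp m V} (h : E.Completes i τ op σ res) :
    ∃ κ, E.IsKey τ κ ∧ (ofLex κ).1 ≤ (E.delivered i σ).ncard := by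
  cases op with
  | write r v =>
    obtain ⟨-, ts, h1, h2⟩ := hE.completes_write h
    exact ⟨_, .write i r v ts i σ h1 h2, writeRank_le h2⟩
  | snapshot => exact ⟨_, .snapshot i σ res h, le_rfl⟩

/-- A message broadcast after `σ` belongs to no set delivered before `σ`, so by the chain property
any set containing it is strictly larger. For a write, the set delivered when the `WRITE` is
broadcast contains the `SYNC` and still has `tsa[r] < ts`; a set reaching `ts` must be larger still.
-/
theorem ncard_delivered_lt_of_isKey (hE : E.IsRun t v₀) {i : Fin n} {τ σ : ℕ}
    {κ : ℕ ×ₗ ℕ ×ₗ Timestamp n ×ₗ ℕ} (h : E.IsKey τ κ) (hσ : σ < τ) :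
    (E.delivered i σ).ncard < (ofLex κ).1 := by
  have key : ∀ {j : Fin n} {x ρ : ℕ} {msg : Msg n m V}, τ < ρ →
      E.event ρ = some (j, .broadcast msg) → msg ∈ E.delivered j x →
      (E.delivered i σ).ncard < (E.delivered j x).ncard := fun h1 h2 h3 =>
    ncard_delivered_lt (hE.scd.deliveredBefore_ssubset h3
      (hE.notMem_delivered_of_broadcast h2 (by omega)))
  rcases h with ⟨i', r, v, ts, j, x, h1, h2⟩ | ⟨i', σ', res, h1⟩
  · obtain ⟨y, h3, ρ, msg, h4, h5, h6⟩ := hE.wrote_spec h1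
    obtain ⟨k, z, h7, h8⟩ := exists_writeRank_eq h2
    change _ < E.writeRank r ts
    rw [← h8]
    refine (key h4 h5 h6).trans ?_
    by_contra hle
    exact (h3.trans_le h7).not_ge (hE.tsa_le_of_subset
      (hE.scd.deliveredBefore_subset_of_ncard_le (not_lt.1 hle)) r)
  · obtain ⟨-, ρ, msg, h3, h4, h5⟩ := hE.completes_snapshot h1
    exact key h3 h4 h5

theorem isKey_lt_of_completes (hE : E.IsRun t v₀) {i : Fin n} {τ τ' σ : ℕ} {op : Op m V}
    {res : Resp m V} {κ κ' : ℕ ×ₗ ℕ ×ₗ Timestamp n ×ₗ ℕ} (h : E.Completes i τ op σ res)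
    (hσ : σ < τ') (hκ : E.IsKey τ κ) (hκ' : E.IsKey τ' κ') : (ofLex κ).1 < (ofLex κ').1 := by
  obtain ⟨κ₁, h1, h2⟩ := hE.exists_isKey_of_completes h
  rw [hE.isKey_unique hκ h1]
  exact h2.trans_lt (hE.ncard_delivered_lt_of_isKey hκ' hσ)

/-- A process is idle when it invokes an operation, so its earlier operation has returned and the
real-time bound applies. -/
theorem isKey_lt_of_lt (hE : E.IsRun t v₀) {i : Fin n} {τ τ' : ℕ} {op op' : Op m V}
    {κ κ' : ℕ ×ₗ ℕ ×ₗ Timestamp n ×ₗ ℕ} (h : E.Invokes i τ op) (h' : E.Invokes i τ' op')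
    (hlt : τ < τ') (hκ : E.IsKey τ κ) (hκ' : E.IsKey τ' κ') : (ofLex κ).1 < (ofLex κ').1 := by
  have hc : ¬ E.Silent i τ τ' := by
    intro hs
    have he := hE.engaged h hlt hs
    simp [hE.control_of_invokes h', Engaged, Control.op] at he
  unfold Silent at hc
  push Not at hc
  obtain ⟨σ, res, h1, h2, h3⟩ := hc
  obtain ⟨σ', h4, res', h5⟩ := exists_completes h h1 h3
  exact hE.isKey_lt_of_completes h5 (by omega) hκ hκ'

theorem isKey_invokes {τ : ℕ} {κ : ℕ ×ₗ ℕ ×ₗ Timestamp n ×ₗ ℕ} (h : E.IsKey τ κ) :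
    ∃ i op, E.Invokes i τ op := by
  rcases h with ⟨i, r, v, ts, j, x, h1, -⟩ | ⟨i, σ, res, h1⟩
  · exact ⟨i, _, h1.1⟩
  · exact ⟨i, _, h1.1⟩

/-- The operations of one process have distinct first components by `isKey_lt_of_lt`, and there are
finitely many processes. -/
theorem finite_isKey_le (hE : E.IsRun t v₀) (K : ℕ) :
    {τ | ∃ κ, E.IsKey τ κ ∧ (ofLex κ).1 ≤ K}.Finite := by
  have hsub : {τ | ∃ κ, E.IsKey τ κ ∧ (ofLex κ).1 ≤ K} ⊆
      ⋃ i : Fin n, {τ | (∃ op, E.Invokes i τ op) ∧ ∃ κ, E.IsKey τ κ ∧ (ofLex κ).1 ≤ K} := by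
    rintro τ ⟨κ, h1, h2⟩
    obtain ⟨i, op, h3⟩ := isKey_invokes h1
    exact Set.mem_iUnion.2 ⟨i, ⟨op, h3⟩, κ, h1, h2⟩
  refine (Set.finite_iUnion fun i => ?_).subset hsub
  have hex : ∀ τ, ∃ κ, (∃ κ, E.IsKey τ κ ∧ (ofLex κ).1 ≤ K) → E.IsKey τ κ ∧ (ofLex κ).1 ≤ K := by
    intro τ
    by_cases h : ∃ κ, E.IsKey τ κ ∧ (ofLex κ).1 ≤ K
    · obtain ⟨κ, hκ⟩ := h
      exact ⟨κ, fun _ => hκ⟩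
    · exact ⟨toLex (0, toLex (0, toLex (toLex (0, ⊥), 0))), fun h' => absurd h' h⟩
  choose f hf using hex
  refine Set.Finite.of_injOn (f := fun τ => (ofLex (f τ)).1) (t := Set.Iic K)
    (fun τ hτ => (hf τ hτ.2).2) ?_ (Set.finite_Iic K)
  rintro τ ⟨⟨op, h1⟩, h2⟩ τ' ⟨⟨op', h1'⟩, h2'⟩ heq
  simp only at heq
  rcases lt_trichotomy τ τ' with hl | hl | hl
  · have := hE.isKey_lt_of_lt h1 h1' hl (hf τ h2).1 (hf τ' h2').1
    omega
  · exact hl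
  · have := hE.isKey_lt_of_lt h1' h1 hl (hf τ' h2').1 (hf τ h2).1
    omega

/-- Two writes of the same register that take part in the linearization have different
timestamps. -/
theorem wrote_injective (hE : E.IsRun t v₀) {τ τ' : ℕ} {i i' j : Fin n} {x : ℕ} {r : Fin m} {v v' : V}
    {ts : Timestamp n} (h : E.Wrote τ i r v ts) (h' : E.Wrote τ' i' r v' ts)
    (hx : ts ≤ (E.state x j).tsa r) : τ = τ' := by
  obtain rfl : i = i' := by
    obtain ⟨-, _, _, _, -, -, -, h1⟩ := h
    obtain ⟨-, _, _, _, -, -, -, h2⟩ := h'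
    rw [h1] at h2
    simpa using congrArg (fun p => (ofLex p).2) h2
  -- Equal timestamps on one register give equal ranks, whereas distinct operations of one process
  -- have different ranks.
  have hk := IsKey.write i r v ts j x h hx
  have hk' := IsKey.write i r v' ts j x h' hx
  rcases lt_trichotomy τ τ' with hl | hl | hl
  · exact absurd (hE.isKey_lt_of_lt h.1 h'.1 hl hk hk') (lt_irrefl _)
  · exact hl
  · exact absurd (hE.isKey_lt_of_lt h'.1 h.1 hl hk' hk) (lt_irrefl _)

/-- As 0 < 1 settles ties, the comparison of keys is `≤` on sizes. A least set reaching `ts` that is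
no larger than the set of the snapshot is contained in it, and `tsa` is monotone. -/
theorem write_lt_snapshot_iff (hE : E.IsRun t v₀) {r : Fin m} {ts : Timestamp n} {i j : Fin n}
    {x σ τ τ' : ℕ} (hx : ts ≤ (E.state x j).tsa r) (ts' : Timestamp n) :
    (toLex (E.writeRank r ts, toLex (0, toLex (ts, τ))) : ℕ ×ₗ ℕ ×ₗ Timestamp n ×ₗ ℕ) <
      toLex ((E.delivered i σ).ncard, toLex (1, toLex (ts', τ'))) ↔
    ts ≤ (E.state σ i).tsa r := by
  have h1 : (toLex (E.writeRank r ts, toLex (0, toLex (ts, τ))) : ℕ ×ₗ ℕ ×ₗ Timestamp n ×ₗ ℕ) <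
      toLex ((E.delivered i σ).ncard, toLex (1, toLex (ts', τ'))) ↔
      E.writeRank r ts ≤ (E.delivered i σ).ncard := by
    rw [Prod.Lex.toLex_lt_toLex, Prod.Lex.toLex_lt_toLex, le_iff_lt_or_eq]
    simp
  rw [h1]
  refine ⟨fun h => ?_, writeRank_le⟩
  obtain ⟨k, z, h7, h8⟩ := exists_writeRank_eq hx
  rw [← h8] at h
  exact h7.trans (hE.tsa_le_of_subset (hE.scd.deliveredBefore_subset_of_ncard_le h) r)

theorem linearizable (hE : E.IsRun t v₀) : E.Linearizable v₀ := by
  have hex : ∀ τ, ∃ κ, (∃ κ, E.IsKey τ κ) → E.IsKey τ κ := by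
    intro τ
    by_cases h : ∃ κ, E.IsKey τ κ
    · obtain ⟨κ, hκ⟩ := h
      exact ⟨κ, fun _ => hκ⟩
    · exact ⟨toLex (0, toLex (0, toLex (toLex (0, ⊥), 0))), fun h' => absurd h' h⟩
  choose f hf using hex
  have hfeq : ∀ {τ κ}, E.IsKey τ κ → f τ = κ := fun h => hE.isKey_unique (hf _ ⟨_, h⟩) h
  obtain ⟨pos, hpos⟩ := exists_position (L := {τ | ∃ κ, E.IsKey τ κ}) (f := f) (by
    intro x _
    refine (hE.finite_isKey_le (ofLex (f x)).1).subset ?_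
    rintro y ⟨hy, hlt⟩
    refine ⟨f y, hf y hy, ?_⟩
    rw [Prod.Lex.lt_iff] at hlt
    rcases hlt with h | h
    · exact h.le
    · exact h.1.le)
  refine ⟨{τ | ∃ κ, E.IsKey τ κ}, pos, fun τ ⟨κ, h⟩ => isKey_invokes h, ?_, ?_, ?_, ?_, ?_⟩
  · intro i τ op σ res h
    obtain ⟨κ, h1, -⟩ := hE.exists_isKey_of_completes h
    exact ⟨κ, h1⟩
  · rintro τ hτ τ' hτ' heq
    have h1 := mt (hpos τ hτ τ' hτ').2 heq.not_lt
    have h2 := mt (hpos τ' hτ' τ hτ).2 heq.symm.not_lt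
    have h3 : f τ = f τ' := le_antisymm (not_lt.1 h2) (not_lt.1 h1)
    have h4 : ∀ {τ κ}, E.IsKey τ κ → (ofLex (ofLex (ofLex κ).2).2).2 = τ := by
      rintro τ κ (_ | _) <;> rfl
    rw [← h4 (hf τ hτ), h3, h4 (hf τ' hτ')]
  · intro i τ op σ res h τ' hτ' hlt
    obtain ⟨κ, h1, -⟩ := hE.exists_isKey_of_completes h
    rw [hpos τ ⟨κ, h1⟩ τ' hτ', Prod.Lex.lt_iff]
    exact Or.inl (hE.isKey_lt_of_completes h hlt (hf τ ⟨κ, h1⟩) (hf τ' hτ'))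
  · intro i τ r v σ res h
    exact (hE.completes_write h).1
  · intro i τ σ res h
    refine ⟨_, (hE.completes_snapshot h).1, fun r => ?_⟩
    have hkey := IsKey.snapshot i σ res h
    have hbefore : ∀ {ρ j v ts k x}, E.Wrote ρ j r v ts → ts ≤ (E.state x k).tsa r →
        (pos ρ < pos τ ↔ ts ≤ (E.state σ i).tsa r) := by
      intro ρ j v ts k x hw hx
      have hk := IsKey.write j r v ts k x hw hx
      rw [hpos ρ ⟨_, hk⟩ τ ⟨_, hkey⟩, hfeq hk, hfeq hkey, hE.write_lt_snapshot_iff hx]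
    have hwrites : ∀ ρ ∈ {τ | ∃ κ, E.IsKey τ κ}, ∀ w, E.WritesOp ρ r w →
        ∃ j ts k x, E.Wrote ρ j r w ts ∧ ts ≤ (E.state x k).tsa r := by
      rintro ρ ⟨κ, hκ⟩ w hw
      rcases hκ with ⟨j, r', v, ts, k, x, h1, h2⟩ | ⟨j, σ', res', h1⟩
      · obtain ⟨rfl, rfl⟩ := wrote_of_writesOp h1 hw
        exact ⟨j, ts, k, x, h1, h2⟩
      · obtain ⟨k, hk⟩ := hw
        cases (h1.1.unique hk).2
    -- Either `tsa[r]` is initial, below every write timestamp, and no write precedes; or it is the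
    -- timestamp of a write, which is the last to precede the snapshot.
    rcases hE.registers_eq i σ r with ⟨h1, h2⟩ | ⟨msg, hm, d, j, hc, hts⟩
    · refine Or.inr ⟨h2, fun ρ hρ w hw hlt => ?_⟩
      obtain ⟨j, ts, k, x, h3, h4⟩ := hwrites ρ hρ w hw
      rw [hbefore h3 h4, h1] at hlt
      exact (hE.initial_lt_of_wrote h3).not_ge hlt
    · obtain ⟨ρ, hρ⟩ := hE.exists_wrote_of_mem_delivered hm hc
      rw [← hts] at hρ
      have hk := IsKey.write j r _ _ i σ hρ le_rfl
      refine Or.inl ⟨ρ, ⟨_, hk⟩, ⟨j, hρ.1⟩, (hbefore hρ le_rfl).2 le_rfl, fun ρ' hρ' w hw hlt => ?_⟩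
      obtain ⟨j', ts, k, x, h3, h4⟩ := hwrites ρ' hρ' w hw
      rw [hbefore h3 h4] at hlt
      rcases hlt.eq_or_lt with rfl | hlt'
      · rw [hE.wrote_injective h3 hρ h4]
      · refine le_of_lt ?_
        have hk' := IsKey.write j' r w ts k x h3 h4
        rw [hpos ρ' ⟨_, hk'⟩ ρ ⟨_, hk⟩, hfeq hk, hfeq hk', Prod.Lex.toLex_lt_toLex,
          Prod.Lex.toLex_lt_toLex, Prod.Lex.toLex_lt_toLex]
        -- A smaller timestamp is reached no later; if at the same size, the timestamps themselves
        -- break the tie.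
        have := writeRank_mono (E := E) (r := r) (x := σ) (j := i) hlt le_rfl
        rcases this.lt_or_eq with h | h
        · exact Or.inl h
        · exact Or.inr ⟨h, Or.inr ⟨rfl, Or.inl hlt'⟩⟩

end IsRun

end Execution

end ScdSnapshot

theorem mainTheorem1 {n m t : ℕ} (ht : t < n) {V : Type*} (v₀ : Fin m → V)
    (E : ScdSnapshot.Execution n m V) (hE : E.IsRun t v₀) :
    E.WaitFree ∧ E.Linearizable v₀ ∧ IsChain (· ≤ ·) E.tsaValues :=
  ⟨hE.waitFree, hE.linearizable, hE.isChain_tsaValues⟩
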